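/- **Dynamic programs.** A \emph{dynamic program} uses a fixed finite relational auxiliary vocabulary and fixed first-order formulas (plain first-order logic with equality, no built-in order or arithmetic), the same for all inputs. Its states are structures over the auxiliary vocabulary, on the universe of the input. The formulas define the first state from the initial input structure, each new state from the previous state and the arguments of the operation performed, and the output predicates from the current state. A dynamic problem is in $\mathrm{DynFO}$ if some dynamic program outputs correct predicates on every initial input, after every admissible finite sequence of operations. **Dyck paths.** Let $V$ be a finite set of vertices and let $L=L^+\cup L^=\cup L^-$ be a finite set of labels with an involution $\ell\mapsto\overline{\ell}$ that maps $L^+$ to $L^-$ and $L^-$ to $L^+$ and fixes every element of $L^=$ (the neutral letters). The set of \emph{Dyck words} over $L$ is generated by $$S\to\varepsilon\;\mid\;\ell\,S\,\overline{\ell}\,S\ (\ell\in L^+\cup L^-)\;\mid\;S\,\bullet\,S\ (\bullet\in L^=).$$ A labelled graph is a set $E\subseteq V\times L\times V$; it is acyclic if it has no nonempty closed path. A \emph{Dyck path} from $s$ to $t$ is a (possibly empty) path $s=s_0\xrightarrow{\ell_0}s_1\cdots\xrightarrow{\ell_{k-1}}s_k=t$ in $E$ such that $\ell_0\cdots\ell_{k-1}$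 is a Dyck word. It is \emph{represented} by the predicate $R$ on $V\times L\times V$ such that $R(u,\ell,v)$ holds if and only if $u=v$ or $(u,\ell,v)=(s_i,\ell_i,s_{i+1})$ for some $i<k$. **Dyck reachability with witness.** The initial input consists of $V$ and $L$, both of arbitrary finite size, presented as a structure with universe $V\sqcup L$ and predicates for $V$, $L^+$, $L^=$, $L^-$ and the graph of $\ell\mapsto\overline{\ell}$. The edge set is initially empty. The operations are the insertion and the deletion of a labelled edge $(u,\ell,v)\in V\times L\times V$; a sequence of operations is admissible if the graph is acyclic at all times. After each admissible sequence, with current edge set $E$, the output has to consist of 1. a predicate that holds for exactly those $(s,t)\in V^2$ such that there is a Dyck path from $s$ to $t$ in $E$; 2. a predicate $W$ such that, for all $s,t\in V$, the predicate $W(s,t,\cdot,\cdot,\cdot)$ on $V\times L\times V$ represents one Dyck path from $s$ to $t$ in $E$ if there is such a path, and is empty otherwise; 3. a predicate that holds for exactly those $(u,\ell,v)\in V\times L\times V$ whose insertion into $E$ leaves the graph acyclic. **Theorem.** Dyck reachability with witness in labelled acyclic graphs is in $\mathrm{DynFO}$. -/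

import Mathlib

/-! ### Dynamic problems and the class DynFO -/

/-- A dynamic problem (in its general form, with output predicates instead of a mere yes/no answer).
* `inLang` is the finite relational vocabulary of the initial inputs; each initial input `i` is a
  finite structure `str i` over that vocabulary, with universe `Univ i`.
* `Op` is the finite set of operation symbols, with their arities; `Upd i` is the set of updates that
  are allowed on input `i`, and `code` presents such an update to a dynamic program as an operation
  symbol applied to elements of the universe.
* `Out` is the finite set of output predicates, with their arities.
* `Admissible i w` says that `w` (in chronological order) is a legal sequence of updates on input
  `i`, and `Correct i w out` that the predicates `out` are a correct answer after that sequence. -/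
structure DynamicProblem where
  inLang : FirstOrder.Language.{0, 0}
  inLang_relational : inLang.IsRelational
  inLang_finite : Finite inLang.Symbols
  Op : Type
  op_finite : Finite Op
  opArity : Op → ℕ
  Out : Type
  out_finite : Finite Out
  outArity : Out → ℕ
  Input : Type 1
  Univ : Input → Type
  univ_finite : ∀ i, Finite (Univ i)
  str : ∀ i, inLang.Structure (Univ i)
  Upd : Input → Type
  code : ∀ i, Upd i → Σ o : Op, (Fin (opArity o) → Univ i)
  Admissible : ∀ i, List (Upd i) → Prop
  Correct : ∀ i, List (Upd i) → (∀ o : Out, (Fin (outArity o) → Univ i) → Prop) → Prop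

/-- A dynamic program all of whose components are first-order formulas (plain first-order logic with
equality, without any built-in order or arithmetic). Its states are structures over the finite
relational auxiliary vocabulary `aux`, on the universe of the input.
* `init R` defines the auxiliary relation `R` of the first state from the initial input.
* `update o R` defines the new relation `R` after an operation with symbol `o`: its free variables
  `Sum.inl _` are the arguments of the operation and `Sum.inr _` the arguments of `R`, and it is
  evaluated in the previous state.
* `output o` defines the output predicate `o` from the current state. -/
structure DynFOProgram (P : DynamicProblem) where
  aux : FirstOrder.Language.{0, 0}
  aux_relational : aux.IsRelational
  aux_finite : Finite aux.Symbols
  init : ∀ {n : ℕ}, aux.Relations n → P.inLang.Formula (Fin n)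
  update : ∀ (o : P.Op) {n : ℕ}, aux.Relations n → aux.Formula (Fin (P.opArity o) ⊕ Fin n)
  output : ∀ o : P.Out, aux.Formula (Fin (P.outArity o))

namespace DynFOProgram

variable {P : DynamicProblem} (M : DynFOProgram P)

/-- The state reached after reading the initial input `S`. -/
@[reducible] def initState {A : Type} (S : P.inLang.Structure A) : M.aux.Structure A where
  funMap := fun f => (M.aux_relational _).elim f
  RelMap := fun R x => @FirstOrder.Language.Formula.Realize P.inLang A S _ (M.init R) x

/-- The state reached from the state `S` by performing one operation. -/
@[reducible] def step {A : Type} (S : M.aux.Structure A) (a : Σ o : P.Op, (Fin (P.opArity o) → A)) :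
    M.aux.Structure A where
  funMap := fun f => (M.aux_relational _).elim f
  RelMap := fun R x =>
    @FirstOrder.Language.Formula.Realize M.aux A S _ (M.update a.1 R) (Sum.elim a.2 x)

/-- The state reached on input `i` after the sequence `w` of updates. -/
@[reducible] def run (i : P.Input) (w : List (P.Upd i)) : M.aux.Structure (P.Univ i) :=
  w.foldl (fun S a => M.step S (P.code i a)) (M.initState (P.str i))

/-- The output predicates on input `i` after the sequence `w` of updates. -/
def out (i : P.Input) (w : List (P.Upd i)) (o : P.Out) (x : Fin (P.outArity o) → P.Univ i) : Prop :=
  @FirstOrder.Language.Formula.Realize M.aux (P.Univ i) (M.run i w) _ (M.output o) x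

end DynFOProgram

/-- `P` is in DynFO: one first-order dynamic program answers correctly on every initial input, after
every admissible sequence of updates. -/
def InDynFO (P : DynamicProblem) : Prop :=
  ∃ M : DynFOProgram P, ∀ (i : P.Input) (w : List (P.Upd i)),
    P.Admissible i w → P.Correct i w (M.out i w)

/-! ### Dyck words and labelled graphs -/

/-- A label alphabet `L = L⁺ ∪ L⁼ ∪ L⁻` with an involution `bar` that exchanges `L⁺` and `L⁻` and
fixes the elements of `L⁼` (the neutral ones). Disjointness of the three sets is not needed. -/
structure DyckAlphabet (L : Type) where
  pos : Set L
  neutral : Set L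
  neg : Set L
  bar : L → L
  cover : pos ∪ neutral ∪ neg = Set.univ
  bar_bar : ∀ l, bar (bar l) = l
  bar_pos : ∀ l ∈ pos, bar l ∈ neg
  bar_neg : ∀ l ∈ neg, bar l ∈ pos
  bar_neutral : ∀ l ∈ neutral, bar l = l

/-- The Dyck words: `S → ε ∣ ℓ S ℓ̄ S ∣ S • S` with `ℓ ∈ L⁺ ∪ L⁻` and `• ∈ L⁼`. -/
inductive IsDyckWord {L : Type} (α : DyckAlphabet L) : List L → Prop
  | nil : IsDyckWord α []
  | pair (l : L) (u v : List L) : l ∈ α.pos ∪ α.neg → IsDyckWord α u → IsDyckWord α v →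
      IsDyckWord α (l :: (u ++ α.bar l :: v))
  | neutral (l : L) (u v : List L) : l ∈ α.neutral → IsDyckWord α u → IsDyckWord α v →
      IsDyckWord α (u ++ l :: v)

/-- `IsPath E s p t`: the sequence `p` of consecutive edges of `E` is a path from `s` to `t`. -/
inductive IsPath {V L : Type} (E : Set (V × L × V)) : V → List (V × L × V) → V → Prop
  | nil (s : V) : IsPath E s [] s
  | cons (s : V) (l : L) (m : V) (p : List (V × L × V)) (t : V) :
      (s, l, m) ∈ E → IsPath E m p t → IsPath E s ((s, l, m) :: p) t

/-- A labelled graph is acyclic if no nonempty path is closed. -/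
def IsAcyclicGraph {V L : Type} (E : Set (V × L × V)) : Prop :=
  ∀ (s : V) (p : List (V × L × V)), IsPath E s p s → p = []

/-- `p` is a Dyck path from `s` to `t`: a path labelled by a Dyck word. -/
def IsDyckPath {V L : Type} (α : DyckAlphabet L) (E : Set (V × L × V))
    (s : V) (p : List (V × L × V)) (t : V) : Prop :=
  IsPath E s p t ∧ IsDyckWord α (p.map fun e => e.2.1)

/-- The predicate `R(u, ℓ, v)` that represents the path `p`. -/
def Represents {V L : Type} (p : List (V × L × V)) (u : V) (l : L) (v : V) : Prop :=
  u = v ∨ (u, l, v) ∈ p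

/-- Insertion and deletion of a labelled edge. -/
inductive EdgeUpdate (V L : Type)
  | ins (u : V) (l : L) (v : V)
  | del (u : V) (l : L) (v : V)

/-- The effect of an update on the set of edges. -/
def EdgeUpdate.apply {V L : Type} (E : Set (V × L × V)) : EdgeUpdate V L → Set (V × L × V)
  | .ins u l v => insert (u, l, v) E
  | .del u l v => E \ {(u, l, v)}

/-- The set of edges after a sequence of updates, starting from the empty set. -/
def edgesAfter {V L : Type} (w : List (EdgeUpdate V L)) : Set (V × L × V) :=
  w.foldl EdgeUpdate.apply ∅

/-! ### The dynamic problem of Dyck reachability with witness -/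

/-- Initial inputs: a finite set `V` of vertices and a finite label alphabet `L` of any size. -/
structure DyckInput where
  V : Type
  L : Type
  finite_V : Finite V
  finite_L : Finite L
  alphabet : DyckAlphabet L

/-- Relation symbols of the initial inputs. -/
inductive DyckRel : ℕ → Type
  | vertex : DyckRel 1
  | pos : DyckRel 1
  | neutral : DyckRel 1
  | neg : DyckRel 1
  | bar : DyckRel 2

/-- The vocabulary of the initial inputs. -/
def dyckLang : FirstOrder.Language.{0, 0} where
  Functions := fun _ => Empty
  Relations := DyckRel

/-- The initial input as a structure, with universe the disjoint union of `V` and `L`. -/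
@[reducible] def dyckStructure (i : DyckInput) : dyckLang.Structure (i.V ⊕ i.L) where
  funMap := fun f => Empty.elim f
  RelMap := fun {_} R => match R with
    | .vertex => fun x => ∃ v, x 0 = Sum.inl v
    | .pos => fun x => ∃ l ∈ i.alphabet.pos, x 0 = Sum.inr l
    | .neutral => fun x => ∃ l ∈ i.alphabet.neutral, x 0 = Sum.inr l
    | .neg => fun x => ∃ l ∈ i.alphabet.neg, x 0 = Sum.inr l
    | .bar => fun x => ∃ l, x 0 = Sum.inr l ∧ x 1 = Sum.inr (i.alphabet.bar l)

/-- The two operation symbols, both of arity 3. -/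
inductive DyckOp
  | ins
  | del

/-- The output predicates: existence of a Dyck path, its witness, and the test whether an insertion
is allowed. -/
inductive DyckOut
  | reach
  | witness
  | allowed

def DyckOut.arity : DyckOut → ℕ
  | .reach => 2
  | .witness => 5
  | .allowed => 3

/-- An update as an operation symbol applied to elements of the universe. -/
def EdgeUpdate.code {V L : Type} : EdgeUpdate V L → Σ _ : DyckOp, (Fin 3 → V ⊕ L)
  | .ins u l v => ⟨.ins, ![Sum.inl u, Sum.inr l, Sum.inl v]⟩
  | .del u l v => ⟨.del, ![Sum.inl u, Sum.inr l, Sum.inl v]⟩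

/-- Correctness of the output predicates for the graph with edge set `E`:
* `reach(s, t)` tells whether there is a Dyck path from `s` to `t`;
* `witness(s, t, ·, ·, ·)` represents one Dyck path from `s` to `t` if there is any, and is empty
  otherwise;
* `allowed(u, ℓ, v)` tells whether the graph remains acyclic when `(u, ℓ, v)` is inserted. -/
def DyckCorrect {V L : Type} (α : DyckAlphabet L) (E : Set (V × L × V))
    (out : ∀ o : DyckOut, (Fin o.arity → V ⊕ L) → Prop) : Prop :=
  (∀ s t : V,
    (out .reach ![Sum.inl s, Sum.inl t] ↔ ∃ p, IsDyckPath α E s p t) ∧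
    ((∃ p, IsDyckPath α E s p t) →
      ∃ p, IsDyckPath α E s p t ∧ ∀ (u : V) (l : L) (v : V),
        out .witness ![Sum.inl s, Sum.inl t, Sum.inl u, Sum.inr l, Sum.inl v] ↔
          Represents p u l v) ∧
    ((¬ ∃ p, IsDyckPath α E s p t) →
      ∀ (u : V) (l : L) (v : V),
        ¬ out .witness ![Sum.inl s, Sum.inl t, Sum.inl u, Sum.inr l, Sum.inl v])) ∧
  (∀ (u : V) (l : L) (v : V),
    out .allowed ![Sum.inl u, Sum.inr l, Sum.inl v] ↔ IsAcyclicGraph (insert (u, l, v) E))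

/-- Dyck reachability with witness in labelled acyclic graphs, under insertions and deletions of
labelled edges that keep the graph acyclic, starting from the empty set of edges. -/
def dyckWitness : DynamicProblem where
  inLang := dyckLang
  inLang_relational := fun _ => (inferInstance : IsEmpty Empty)
  inLang_finite := by
    have h1 : Finite (Σ n, dyckLang.Functions n) :=
      @Finite.of_subsingleton _ ⟨fun a => Empty.elim a.2⟩
    have h2 : Finite (Σ n, dyckLang.Relations n) := by
      refine Set.finite_univ_iff.mp (Set.Finite.subset (Set.toFinite
        ({⟨1, DyckRel.vertex⟩, ⟨1, DyckRel.pos⟩, ⟨1, DyckRel.neutral⟩, ⟨1, DyckRel.neg⟩,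
          ⟨2, DyckRel.bar⟩} : Set (Σ n, dyckLang.Relations n))) ?_)
      rintro ⟨n, R⟩ -
      cases R <;> simp
    exact inferInstanceAs (Finite (_ ⊕ _))
  Op := DyckOp
  op_finite := Finite.of_surjective (fun b : Bool => if b then DyckOp.ins else DyckOp.del) (by
    rintro (_ | _)
    · exact ⟨true, rfl⟩
    · exact ⟨false, rfl⟩)
  opArity := fun _ => 3
  Out := DyckOut
  out_finite := Finite.of_surjective
    (![DyckOut.reach, DyckOut.witness, DyckOut.allowed] : Fin 3 → DyckOut) (by
    rintro (_ | _ | _)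
    · exact ⟨0, rfl⟩
    · exact ⟨1, rfl⟩
    · exact ⟨2, rfl⟩)
  outArity := DyckOut.arity
  Input := DyckInput
  Univ := fun i => i.V ⊕ i.L
  univ_finite := fun i => @Finite.instSum _ _ i.finite_V i.finite_L
  str := dyckStructure
  Upd := fun i => EdgeUpdate i.V i.L
  code := fun _ a => a.code
  Admissible := fun _ w => ∀ w', w' <+: w → IsAcyclicGraph (edgesAfter w')
  Correct := fun i w out => DyckCorrect i.alphabet (edgesAfter w) out

/-! Dyck reachability alone is awkward to update, since the pieces of a Dyck path need not be Dyck
paths. The program therefore maintains Dyck pairs (`DyckState.rel`): paths x₁ → y₁ and x₂ → y₂ whose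
labels, concatenated, form a Dyck word. A single Dyck path is a pair whose second path is closed,
hence empty by acyclicity.

An operation acts on paths in a controlled way (`Transition`): a path of the new graph either is an
old path, with end points for which every old path survives, or splits at a pivot edge into two old
paths. For an insertion the pivot is the new edge; for a deletion it leaves the set of vertices that
reach the source of the deleted edge.

Let the second path of a pair be q₁ (c,l,d) q₂ and the first one p. If l is matched with a letter of
p, nesting leaves two smaller pairs. If l is neutral or matched inside the second path, removing the
matched block leaves three paths whose labels together form a Dyck word. The matching does not
cross, so it splits them into three pairs (`BalancedWord.tripod`). Hence boundedly many quantifiers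
and queries to old pairs suffice (`Correct.stage_decides`). Pairs are symmetric by
`BalancedWord.rotate`, so the argument applied twice renews both paths.

Witnesses are unions of stored edge sets, but one witness has to be chosen among many without a
built-in order. The program orders elements by their first use in an insertion. All end points and
labels of edges are among these, so every existential quantifier can take its least solution
(`Witnessed.ex`). -/

/-! ### Balanced words -/

/-- The Dyck words over neutral letters `N` and a matching relation `M`. -/
inductive BalancedWord {U : Type} (N : U → Prop) (M : U → U → Prop) : List U → Prop
  | nil : BalancedWord N M []
  | pair (a b : U) (u v : List U) : M a b → BalancedWord N M u → BalancedWord N M v →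
      BalancedWord N M (a :: (u ++ b :: v))
  | neutral (a : U) (u v : List U) : N a → BalancedWord N M u → BalancedWord N M v →
      BalancedWord N M (u ++ a :: v)

namespace BalancedWord

variable {U : Type} {N : U → Prop} {M : U → U → Prop}

theorem append {u v : List U} (hu : BalancedWord N M u) (hv : BalancedWord N M v) :
    BalancedWord N M (u ++ v) := by
  induction hu with
  | nil => simpa using hv
  | pair a b u w h hu _ _ ih => simpa using BalancedWord.pair a b u _ h hu ih
  | neutral a u w h hu _ _ ih => simpa using BalancedWord.neutral a u _ h hu ih

theorem enclose {a b : U} {u : List U} (h : M a b) (hu : BalancedWord N M u) :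
    BalancedWord N M (a :: (u ++ [b])) := .pair a b u [] h hu .nil

theorem single {a : U} (h : N a) : BalancedWord N M [a] := .neutral a [] [] h .nil .nil

theorem insert {u v w : List U} (h : BalancedWord N M (u ++ v)) (hw : BalancedWord N M w) :
    BalancedWord N M (u ++ (w ++ v)) := by
  generalize hx : u ++ v = x at h
  induction h generalizing u v with
  | nil =>
    obtain ⟨rfl, rfl⟩ := List.append_eq_nil_iff.1 hx
    simpa using hw
  | pair a b x y hM hx' hy ihx ihy =>
    rcases u with _ | ⟨a', u⟩
    · obtain rfl : v = _ := hx
      exact hw.append (.pair a b x y hM hx' hy)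
    · obtain ⟨rfl, hx₁⟩ : a' = a ∧ u ++ v = x ++ b :: y := by simpa using hx
      rcases List.append_eq_append_iff.1 hx₁ with ⟨c, rfl, rfl⟩ | ⟨c, rfl, hc⟩
      · simpa using BalancedWord.pair a' b _ y hM (ihx rfl) hy
      · rcases c with _ | ⟨b', c⟩
        · obtain rfl : v = b :: y := hc.symm
          simpa using BalancedWord.pair a' b _ y hM (hx'.append hw) hy
        · obtain ⟨rfl, rfl⟩ := List.cons.inj hc
          simpa using BalancedWord.pair a' b _ _ hM hx' (ihy rfl)
  | neutral a x y hN hx' hy ihx ihy =>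
    rcases List.append_eq_append_iff.1 hx with ⟨c, rfl, rfl⟩ | ⟨c, rfl, hc⟩
    · simpa using BalancedWord.neutral a _ y hN (ihx rfl) hy
    · rcases c with _ | ⟨b', c⟩
      · obtain rfl : v = a :: y := hc.symm
        simpa using BalancedWord.neutral a _ y hN (hx'.append hw) hy
      · obtain ⟨rfl, rfl⟩ := List.cons.inj hc
        simpa using BalancedWord.neutral a _ _ hN hx' (ihy rfl)

/-- A letter of a balanced word is neutral, or it is matched with a later or an earlier letter. -/
theorem remove {u v : List U} {l : U} (h : BalancedWord N M (u ++ l :: v)) :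
    (N l ∧ BalancedWord N M (u ++ v)) ∨
    (∃ v₁ b v₂, v = v₁ ++ b :: v₂ ∧ M l b ∧ BalancedWord N M v₁ ∧ BalancedWord N M (u ++ v₂)) ∨
    (∃ u₁ a u₂, u = u₁ ++ a :: u₂ ∧ M a l ∧ BalancedWord N M u₂ ∧ BalancedWord N M (u₁ ++ v)) := by
  generalize hx : u ++ l :: v = x at h
  induction h generalizing u v with
  | nil => simp at hx
  | pair a b x y hM hx' hy ihx ihy =>
    rcases u with _ | ⟨a', u⟩
    · obtain ⟨rfl, rfl⟩ := List.cons.inj hx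
      exact .inr (.inl ⟨x, b, y, rfl, hM, hx', hy⟩)
    · obtain ⟨rfl, hx₁⟩ : a' = a ∧ u ++ l :: v = x ++ b :: y := by simpa using hx
      -- `key` covers `l` at the closing letter or behind it. Both alternatives of
      -- `List.append_eq_append_iff` need it, because the border between the factors falls under
      -- either of them.
      have key : ∀ c, u = x ++ c → b :: y = c ++ l :: v →
          (N l ∧ BalancedWord N M (a' :: u ++ v)) ∨
          (∃ v₁ b v₂, v = v₁ ++ b :: v₂ ∧ M l b ∧ BalancedWord N M v₁ ∧
            BalancedWord N M (a' :: u ++ v₂)) ∨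
          (∃ u₁ a u₂, a' :: u = u₁ ++ a :: u₂ ∧ M a l ∧ BalancedWord N M u₂ ∧
            BalancedWord N M (u₁ ++ v)) := by
        rintro c rfl hc
        rcases c with _ | ⟨b', c⟩
        · obtain ⟨rfl, rfl⟩ := List.cons.inj hc
          exact .inr (.inr ⟨[], a', x, by simp, hM, hx', hy⟩)
        · obtain ⟨rfl, rfl⟩ := List.cons.inj hc
          rcases ihy rfl with ⟨h, h'⟩ | ⟨v₁, d, v₂, rfl, h, h₁, h₂⟩ | ⟨u₁, d, u₂, rfl, h, h₁, h₂⟩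
          · exact .inl ⟨h, by simpa using BalancedWord.pair a' b _ _ hM hx' h'⟩
          · exact .inr (.inl ⟨v₁, d, v₂, rfl, h, h₁,
              by simpa using BalancedWord.pair a' b _ _ hM hx' h₂⟩)
          · exact .inr (.inr ⟨a' :: (x ++ b :: u₁), d, u₂, by simp, h, h₁,
              by simpa using BalancedWord.pair a' b _ _ hM hx' h₂⟩)
      rcases List.append_eq_append_iff.1 hx₁ with ⟨c, rfl, hc⟩ | ⟨c, hu, hc⟩
      · rcases c with _ | ⟨b', c⟩
        · exact key [] (by simp) (by simpa using hc.symm)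
        · obtain ⟨rfl, rfl⟩ := List.cons.inj hc
          rcases ihx rfl with ⟨h, h'⟩ | ⟨v₁, d, v₂, rfl, h, h₁, h₂⟩ | ⟨u₁, d, u₂, rfl, h, h₁, h₂⟩
          · exact .inl ⟨h, by simpa using BalancedWord.pair a' b _ _ hM h' hy⟩
          · exact .inr (.inl ⟨v₁, d, v₂ ++ b :: y, by simp, h, h₁,
              by simpa using BalancedWord.pair a' b _ _ hM h₂ hy⟩)
          · exact .inr (.inr ⟨a' :: u₁, d, u₂, by simp, h, h₁,
              by simpa using BalancedWord.pair a' b _ _ hM h₂ hy⟩)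
      · exact key c hu hc
  | neutral a x y hN hx' hy ihx ihy =>
    have key : ∀ c, u = x ++ c → a :: y = c ++ l :: v →
        (N l ∧ BalancedWord N M (u ++ v)) ∨
        (∃ v₁ b v₂, v = v₁ ++ b :: v₂ ∧ M l b ∧ BalancedWord N M v₁ ∧
          BalancedWord N M (u ++ v₂)) ∨
        (∃ u₁ a u₂, u = u₁ ++ a :: u₂ ∧ M a l ∧ BalancedWord N M u₂ ∧
          BalancedWord N M (u₁ ++ v)) := by
      rintro c rfl hc
      rcases c with _ | ⟨b', c⟩
      · obtain ⟨rfl, rfl⟩ := List.cons.inj hc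
        exact .inl ⟨hN, by simpa using hx'.append hy⟩
      · obtain ⟨rfl, rfl⟩ := List.cons.inj hc
        rcases ihy rfl with ⟨h, h'⟩ | ⟨v₁, d, v₂, rfl, h, h₁, h₂⟩ | ⟨u₁, d, u₂, rfl, h, h₁, h₂⟩
        · exact .inl ⟨h, by simpa using BalancedWord.neutral a _ _ hN hx' h'⟩
        · exact .inr (.inl ⟨v₁, d, v₂, rfl, h, h₁,
            by simpa using BalancedWord.neutral a _ _ hN hx' h₂⟩)
        · exact .inr (.inr ⟨x ++ a :: u₁, d, u₂, by simp, h, h₁,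
            by simpa using BalancedWord.neutral a _ _ hN hx' h₂⟩)
    rcases List.append_eq_append_iff.1 hx with ⟨c, rfl, hc⟩ | ⟨c, hu, hc⟩
    · rcases c with _ | ⟨b', c⟩
      · exact key [] (by simp) (by simpa using hc.symm)
      · obtain ⟨rfl, rfl⟩ := List.cons.inj hc
        rcases ihx rfl with ⟨h, h'⟩ | ⟨v₁, d, v₂, rfl, h, h₁, h₂⟩ | ⟨u₁, d, u₂, rfl, h, h₁, h₂⟩
        · exact .inl ⟨h, by simpa using BalancedWord.neutral a _ _ hN h' hy⟩
        · exact .inr (.inl ⟨v₁, d, v₂ ++ a :: y, by simp, h, h₁,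
            by simpa using BalancedWord.neutral a _ _ hN h₂ hy⟩)
        · exact .inr (.inr ⟨u₁, d, u₂, by simp, h, h₁,
            by simpa using BalancedWord.neutral a _ _ hN h₂ hy⟩)
    · exact key c hu hc

/-- It suffices to move the first letter to the end. If it was matched with `d`, its arc now opens
at `d` instead, which is where symmetry of the matching enters. -/
theorem rotate (hM : ∀ a b, M a b → M b a) {u v : List U} (h : BalancedWord N M (u ++ v)) :
    BalancedWord N M (v ++ u) := by
  induction u generalizing v with
  | nil => simpa using h
  | cons a u ih =>
    have : BalancedWord N M (u ++ (v ++ [a])) := by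
      rcases remove (u := []) h with ⟨h, h'⟩ | ⟨v₁, d, v₂, hv, h, h₁, h₂⟩ | ⟨u₁, d, u₂, hu, _⟩
      · simpa using BalancedWord.neutral a _ [] h h' .nil
      · replace hv : u ++ v = v₁ ++ d :: v₂ := hv
        rw [← List.append_assoc, hv]
        simpa using h₁.append (enclose (hM _ _ h) h₂)
      · simp at hu
    simpa using ih this

/-- The matching of a balanced word that is cut into three parts. -/
theorem tripod {u v w : List U} (h : BalancedWord N M (u ++ (v ++ w))) :
    ∃ u₁ u₂ v₁ v₂ w₁ w₂, u = u₁ ++ u₂ ∧ v = v₁ ++ v₂ ∧ w = w₁ ++ w₂ ∧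
      BalancedWord N M (u₂ ++ v₁) ∧ BalancedWord N M (v₂ ++ w₁) ∧ BalancedWord N M (u₁ ++ w₂) := by
  -- Each round strips the first letter of the middle part, along with its partner and what they
  -- enclose, and `insert` puts the block back afterwards. A partner in `w` ends the recursion: the
  -- whole rest of the middle part then lies under that arc.
  induction hn : v.length using Nat.strong_induction_on generalizing u v w with
  | _ n ih =>
    rcases v with _ | ⟨l, v⟩
    · exact ⟨u, [], [], [], [], w, by simp, rfl, rfl, .nil, .nil, h⟩
    subst hn
    rcases remove h with ⟨hl, h'⟩ | ⟨v₁, d, v₂, hv, hl, h₁, h₂⟩ | ⟨u₁, d, u₂, rfl, hl, h₁, h₂⟩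
    · obtain ⟨u₁, u₂, v₁, v₂, w₁, w₂, rfl, rfl, rfl, h₁, h₂, h₃⟩ := ih v.length (by simp) h' rfl
      exact ⟨u₁, u₂, l :: v₁, v₂, w₁, w₂, rfl, rfl, rfl, insert h₁ (single hl), h₂, h₃⟩
    · have key : ∀ c, v₁ = v ++ c → w = c ++ d :: v₂ →
          ∃ u₁ u₂ x₁ x₂ w₁ w₂, u = u₁ ++ u₂ ∧ l :: v = x₁ ++ x₂ ∧ w = w₁ ++ w₂ ∧
            BalancedWord N M (u₂ ++ x₁) ∧ BalancedWord N M (x₂ ++ w₁) ∧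
            BalancedWord N M (u₁ ++ w₂) := by
        rintro c rfl rfl
        exact ⟨u, [], [], l :: v, c ++ [d], v₂, by simp, by simp, by simp, .nil,
          by simpa using enclose hl h₁, h₂⟩
      rcases List.append_eq_append_iff.1 hv with ⟨c, hv₁, hw⟩ | ⟨c, rfl, hc⟩
      · exact key c hv₁ hw
      · rcases c with _ | ⟨d', c⟩
        · exact key [] (by simp) (by simpa using hc.symm)
        · obtain ⟨rfl, rfl⟩ := List.cons.inj hc
          obtain ⟨u₁, u₂, c₁, c₂, w₁, w₂, rfl, rfl, rfl, h₃, h₄, h₅⟩ :=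
            ih c.length (by simp; omega) h₂ rfl
          exact ⟨u₁, u₂, l :: (v₁ ++ d :: c₁), c₂, w₁, w₂, rfl, by simp, rfl,
            by simpa using insert h₃ (enclose hl h₁), h₄, h₅⟩
    · obtain ⟨p₁, p₂, v₁, v₂, w₁, w₂, rfl, rfl, rfl, h₃, h₄, h₅⟩ := ih v.length (by simp) h₂ rfl
      exact ⟨p₁, p₂ ++ d :: u₂, l :: v₁, v₂, w₁, w₂, by simp, by simp, rfl,
        by simpa using insert h₃ (enclose hl h₁), h₄, h₅⟩

end BalancedWord

/-! ### Paths -/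

section Paths

variable {V L : Type} {E E' : Set (V × L × V)}

theorem isPath_cons_iff {s t : V} {e : V × L × V} {p : List (V × L × V)} :
    IsPath E s (e :: p) t ↔ e.1 = s ∧ e ∈ E ∧ IsPath E e.2.2 p t := by
  constructor
  · rintro ⟨⟩
    exact ⟨rfl, by assumption, by assumption⟩
  · rintro ⟨rfl, h, h'⟩
    exact .cons _ _ _ _ _ h h'

theorem isPath_nil_iff {s t : V} : IsPath E s [] t ↔ s = t :=
  ⟨by rintro ⟨⟩; rfl, by rintro rfl; exact .nil _⟩

theorem isPath_append_iff {s t : V} {p q : List (V × L × V)} :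
    IsPath E s (p ++ q) t ↔ ∃ m, IsPath E s p m ∧ IsPath E m q t := by
  induction p generalizing s with
  | nil => simp [isPath_nil_iff]
  | cons e p ih => simp [isPath_cons_iff, ih, and_assoc]

theorem IsPath.append {s m t : V} {p q : List (V × L × V)} (hp : IsPath E s p m)
    (hq : IsPath E m q t) : IsPath E s (p ++ q) t := isPath_append_iff.2 ⟨m, hp, hq⟩

theorem IsPath.mono_of_mem {s t : V} {p : List (V × L × V)} (hp : IsPath E s p t)
    (h : ∀ e ∈ p, e ∈ E → e ∈ E') : IsPath E' s p t := by
  induction hp with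
  | nil s => exact .nil s
  | cons s l m p t he _ ih =>
    exact .cons _ _ _ _ _ (h _ (by simp) he) (ih fun e h' => h e (by simp [h']))

theorem IsPath.mono {s t : V} {p : List (V × L × V)} (hp : IsPath E s p t) (h : E ⊆ E') :
    IsPath E' s p t := hp.mono_of_mem fun _ _ h' => h h'

theorem IsPath.eq_or_source {s t : V} {p : List (V × L × V)} (hp : IsPath E s p t) :
    s = t ∨ ∃ l v, (s, l, v) ∈ E := by
  cases hp with
  | nil => exact .inl rfl
  | cons _ l m _ _ he _ => exact .inr ⟨l, m, he⟩

theorem IsPath.eq_or_target {s t : V} {p : List (V × L × V)} (hp : IsPath E s p t) :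
    s = t ∨ ∃ v l, (v, l, t) ∈ E := by
  induction hp with
  | nil => exact .inl rfl
  | cons s l m p t he hp ih =>
    rcases ih with rfl | h
    · exact .inr ⟨s, l, he⟩
    · exact .inr h

/-- A path of an acyclic graph does not use an edge twice. -/
theorem IsAcyclicGraph.notMem (hE : IsAcyclicGraph E) {s t : V} {p q : List (V × L × V)}
    {e : V × L × V} (h : IsPath E s (p ++ e :: q) t) : e ∉ p ∧ e ∉ q := by
  obtain ⟨m, hp, hq⟩ := isPath_append_iff.1 h
  obtain ⟨rfl, he, hq⟩ := isPath_cons_iff.1 hq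
  constructor
  · intro h
    obtain ⟨p₁, p₂, rfl⟩ := List.append_of_mem h
    obtain ⟨m, -, hp⟩ := isPath_append_iff.1 hp
    obtain ⟨rfl, he, hp⟩ := isPath_cons_iff.1 hp
    simpa using hE _ (e :: p₂) (isPath_cons_iff.2 ⟨rfl, he, hp⟩)
  · intro h
    obtain ⟨p₁, p₂, rfl⟩ := List.append_of_mem h
    obtain ⟨m, hp, hq⟩ := isPath_append_iff.1 hq
    obtain ⟨rfl, -, -⟩ := isPath_cons_iff.1 hq
    simpa using hE _ (e :: p₁) (isPath_cons_iff.2 ⟨rfl, he, hp⟩)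

theorem isAcyclicGraph_insert_iff (hE : IsAcyclicGraph E) {u v : V} {l : L} :
    IsAcyclicGraph (insert (u, l, v) E) ↔ ¬ ∃ p, IsPath E v p u := by
  constructor
  · rintro h ⟨p, hp⟩
    simpa using h u _ (isPath_cons_iff.2
      ⟨rfl, Set.mem_insert (u, l, v) E, hp.mono (Set.subset_insert _ _)⟩)
  · intro h s p hp
    by_cases hm : (u, l, v) ∈ p
    · refine (h ?_).elim
      -- What follows an occurrence of the new edge is a shorter path that starts at `v` again and
      -- has the same end, so repeated dropping reaches a path without the new edge.
      have key : ∀ (n : ℕ) (p : List (V × L × V)) (t : V), p.length ≤ n →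
          IsPath (insert (u, l, v) E) v p t → ∃ q, IsPath E v q u ∨ IsPath E v q t := by
        intro n
        induction n with
        | zero =>
          intro p t hn hp
          obtain rfl : p = [] := by simpa using hn
          exact ⟨[], .inr ((isPath_nil_iff.1 hp) ▸ .nil _)⟩
        | succ n ih =>
          intro p t hn hp
          by_cases hm : (u, l, v) ∈ p
          · obtain ⟨p₁, p₂, rfl⟩ := List.append_of_mem hm
            obtain ⟨m, -, hp⟩ := isPath_append_iff.1 hp
            obtain ⟨-, -, hp⟩ := isPath_cons_iff.1 hp
            exact ih p₂ t (by simp at hn; omega) hp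
          · exact ⟨p, .inr (hp.mono_of_mem fun e he h =>
              h.resolve_left fun h => hm (h ▸ he))⟩
      obtain ⟨p₁, p₂, rfl⟩ := List.append_of_mem hm
      obtain ⟨m, hp₁, hp⟩ := isPath_append_iff.1 hp
      obtain ⟨hm, -, hp₂⟩ := isPath_cons_iff.1 hp
      obtain rfl : u = m := hm
      obtain ⟨q, hq⟩ := key _ _ _ le_rfl (hp₂.append hp₁)
      exact ⟨q, hq.elim id id⟩
    · exact hE s p (hp.mono_of_mem fun e he h => h.resolve_left fun h => hm (h ▸ he))

end Paths

/-! ### Statements with witnessing edge sets -/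

/-- A proposition together with a set of edges, which is meaningful if the proposition holds. -/
structure Witnessed (U : Type) where
  holds : Prop
  wit : U → U → U → Prop

namespace Witnessed

variable {U : Type}

/-- `a` precedes all activated elements that satisfy `φ`. -/
def IsLeast (ord : U → U → Prop) (φ : U → Prop) (a : U) : Prop :=
  ord a a ∧ φ a ∧ ∀ b, ord b b → φ b → ord a b

def single (h : Prop) (a l b : U) : Witnessed U := ⟨h, fun x y z => x = a ∧ y = l ∧ z = b⟩

def empty (h : Prop) : Witnessed U := ⟨h, fun _ _ _ => False⟩

def guard (h : Prop) (w : Witnessed U) : Witnessed U := ⟨h ∧ w.holds, w.wit⟩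

def and (w w' : Witnessed U) : Witnessed U :=
  ⟨w.holds ∧ w'.holds, fun x y z => w.wit x y z ∨ w'.wit x y z⟩

/-- The first alternative is preferred. -/
def or (w w' : Witnessed U) : Witnessed U :=
  ⟨w.holds ∨ w'.holds, fun x y z => (w.holds ∧ w.wit x y z) ∨ (¬ w.holds ∧ w'.wit x y z)⟩

/-- Existence of an activated element; the least one is used. -/
def ex (ord : U → U → Prop) (w : U → Witnessed U) : Witnessed U :=
  ⟨∃ a, ord a a ∧ (w a).holds,
    fun x y z => ∃ a, IsLeast ord (fun b => (w b).holds) a ∧ (w a).wit x y z⟩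

/-- If `w` holds, then its witness satisfies `Q`. -/
def Sound (w : Witnessed U) (Q : (U → U → U → Prop) → Prop) : Prop := w.holds → Q w.wit

variable {Q : (U → U → U → Prop) → Prop} {w w' : Witnessed U} {ord : U → U → Prop}

theorem Sound.guard {h : Prop} (hw : h → w.Sound Q) : (w.guard h).Sound Q :=
  fun h' => hw h'.1 h'.2

theorem Sound.or (hw : w.Sound Q) (hw' : w'.Sound Q) : (w.or w').Sound Q := by
  intro h
  by_cases hh : w.holds
  · simpa [Witnessed.or, hh] using hw hh
  · simpa [Witnessed.or, hh] using hw' (h.resolve_left hh)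

/-- The first witness is absorbed into the predicate required of the second. Facts extracted from
the first component are thus available when the second is treated. -/
theorem Sound.and (hw : w.holds → w'.Sound fun S => Q fun x y z => w.wit x y z ∨ S x y z) :
    (w.and w').Sound Q := fun h => hw h.1 h.2

theorem and_wit {x y z : U} : (w.and w').wit x y z ↔ w.wit x y z ∨ w'.wit x y z := Iff.rfl

theorem single_wit {h : Prop} {a l b x y z : U} :
    (single h a l b).wit x y z ↔ x = a ∧ y = l ∧ z = b := Iff.rfl

/-- `ord` orders the activated elements, i.e. those with `ord a a`, by their time of activation. -/
def IsActivationOrder (ord : U → U → Prop) : Prop :=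
  ∃ (rank : U → ℕ) (n : ℕ), (∀ a, rank a ≤ n) ∧ (∀ a b, rank a ≠ 0 → rank a = rank b → a = b) ∧
    ∀ a b, ord a b ↔ rank a ≠ 0 ∧ rank a ≤ rank b

theorem IsActivationOrder.existsUnique (h : IsActivationOrder ord) {φ : U → Prop}
    (hφ : ∃ a, ord a a ∧ φ a) : ∃! a, IsLeast ord φ a := by
  obtain ⟨rank, n, -, hinj, hord⟩ := h
  have hm := Function.argminOn_mem rank {a | ord a a ∧ φ a} hφ
  have hle := fun b hb => Function.argminOn_le rank {a | ord a a ∧ φ a} (a := b) hb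
  refine ⟨_, ⟨hm.1, hm.2, fun b hb hb' => ?_⟩, fun b ⟨hb, hb', hmin⟩ => ?_⟩
  · exact (hord _ _).2 ⟨((hord _ _).1 hm.1).1, hle b ⟨hb, hb'⟩⟩
  · exact hinj _ _ ((hord _ _).1 hb).1
      (le_antisymm ((hord _ _).1 (hmin _ hm.1 hm.2)).2 (hle b ⟨hb, hb'⟩))

/-- Since the least solution is unique, the witness is that of a single solution and not a mixture
of several. -/
theorem Sound.ex (ho : IsActivationOrder ord) {w : U → Witnessed U}
    (hw : ∀ a, (w a).Sound Q) : (Witnessed.ex ord w).Sound Q := by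
  intro h
  obtain ⟨a, ha, hu⟩ := ho.existsUnique h
  have : (Witnessed.ex ord w).wit = (w a).wit := by
    funext x y z
    refine propext ⟨?_, fun h => ⟨a, ha, h⟩⟩
    rintro ⟨b, hb, h⟩
    obtain rfl := hu b hb
    exact h
  rw [this]
  exact hw a ha.2.1

end Witnessed

/-- Activation of the element `z`, after all elements activated before. -/
def activate {U : Type} (ord : U → U → Prop) (z a b : U) : Prop :=
  ord a b ∨ ¬ ord z z ∧ b = z ∧ (ord a a ∨ a = z)

theorem Witnessed.IsActivationOrder.activate {U : Type} {ord : U → U → Prop}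
    (h : IsActivationOrder ord) (z : U) : IsActivationOrder (activate ord z) := by
  classical
  obtain ⟨rank, n, hn, hinj, hord⟩ := h
  by_cases hz : rank z = 0
  -- Rank 0 means not activated. As `n` bounds all ranks, `n + 1` is a fresh last one.
  · refine ⟨Function.update rank z (n + 1), n + 1, fun a => ?_, fun a b => ?_, fun a b => ?_⟩
    · have := hn a
      by_cases h : a = z
      · simp [h]
      · simp [h]; omega
    · have ha := hn a
      have hb := hn b
      by_cases h : a = z <;> by_cases h' : b = z <;>
        simp only [h, h', Function.update_self, Function.update_of_ne, ne_eq, not_false_eq_true]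
      · simp
      · omega
      · omega
      · exact hinj a b
    · have ha := hn a
      by_cases h : a = z <;> by_cases h' : b = z <;>
        simp [h, h', _root_.activate, hord, hz]
      · have := hn b
        omega
      · omega
  · have : _root_.activate ord z = ord := by
      funext a b
      simp [_root_.activate, hord, hz]
    rw [this]
    exact ⟨rank, n, hn, hinj, hord⟩

theorem activate_of_ord {U : Type} {ord : U → U → Prop} {z a b : U} (h : ord a b) :
    activate ord z a b := .inl h

theorem activate_self {U : Type} {ord : U → U → Prop} {z : U} : activate ord z z z := by
  by_cases h : ord z z
  · exact .inl h
  · exact .inr ⟨h, rfl, .inr rfl⟩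

/-! ### States -/

/-- The information that the dynamic program maintains. The universe serves both as the set of
vertices and as the set of labels. -/
structure DyckState (U : Type) where
  edge : U → U → U → Prop
  reach : U → U → Prop
  ord : U → U → Prop
  neutral : U → Prop
  matching : U → U → Prop
  rel : U → U → U → U → Prop
  wit : U → U → U → U → U → U → U → Prop

def edgeSet {U : Type} (e : U → U → U → Prop) : Set (U × U × U) := {x | e x.1 x.2.1 x.2.2}

def labels {V L : Type} (p : List (V × L × V)) : List L := p.map fun e => e.2.1

@[simp] theorem labels_nil {V L : Type} : labels ([] : List (V × L × V)) = [] := rfl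

@[simp] theorem labels_cons {V L : Type} (e : V × L × V) (p : List (V × L × V)) :
    labels (e :: p) = e.2.1 :: labels p := rfl

@[simp] theorem labels_append {V L : Type} (p q : List (V × L × V)) :
    labels (p ++ q) = labels p ++ labels q := List.map_append

theorem labels_eq_append {V L : Type} {p : List (V × L × V)} {u v : List L}
    (h : labels p = u ++ v) : ∃ q r, p = q ++ r ∧ labels q = u ∧ labels r = v :=
  List.map_eq_append_iff.1 h

theorem labels_eq_append_cons {V L : Type} {p : List (V × L × V)} {u v : List L} {l : L}
    (h : labels p = u ++ l :: v) :
    ∃ q a b r, p = q ++ (a, l, b) :: r ∧ labels q = u ∧ labels r = v := by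
  obtain ⟨q, r, rfl, rfl, hr⟩ := labels_eq_append h
  obtain ⟨⟨a, l', b⟩, r, rfl, rfl, rfl⟩ := List.map_eq_cons_iff.1 hr
  exact ⟨q, a, b, r, rfl, rfl, rfl⟩

/-- `S` is the set of edges of two paths, one with edges in `E₁` and one with edges in `E₂`, whose
labels together form a Dyck word. -/
def IsDyckPair {U : Type} (N : U → Prop) (M : U → U → Prop) (E₁ E₂ : Set (U × U × U))
    (x₁ y₁ x₂ y₂ : U) (S : U → U → U → Prop) : Prop :=
  ∃ p q, IsPath E₁ x₁ p y₁ ∧ IsPath E₂ x₂ q y₂ ∧ BalancedWord N M (labels p ++ labels q) ∧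
    ∀ a l b, S a l b ↔ (a, l, b) ∈ p ∨ (a, l, b) ∈ q

/-- `W` correctly decides the existence of Dyck pairs and provides witnesses. -/
structure DecidesPairs {U : Type} (N : U → Prop) (M : U → U → Prop) (E₁ E₂ : Set (U × U × U))
    (W : U → U → U → U → Witnessed U) : Prop where
  sound : ∀ x₁ y₁ x₂ y₂, (W x₁ y₁ x₂ y₂).Sound (IsDyckPair N M E₁ E₂ x₁ y₁ x₂ y₂)
  complete : ∀ x₁ y₁ x₂ y₂ p q, IsPath E₁ x₁ p y₁ → IsPath E₂ x₂ q y₂ →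
    BalancedWord N M (labels p ++ labels q) → (W x₁ y₁ x₂ y₂).holds

theorem DecidesPairs.swap {U : Type} {N : U → Prop} {M : U → U → Prop}
    (hM : ∀ a b, M a b → M b a) {E₁ E₂ : Set (U × U × U)} {W : U → U → U → U → Witnessed U}
    (h : DecidesPairs N M E₁ E₂ W) :
    DecidesPairs N M E₂ E₁ fun x₁ y₁ x₂ y₂ => W x₂ y₂ x₁ y₁ where
  sound x₁ y₁ x₂ y₂ hw := by
    obtain ⟨p, q, hp, hq, hb, hS⟩ := h.sound _ _ _ _ hw
    exact ⟨q, p, hq, hp, hb.rotate hM, fun a l b => (hS a l b).trans or_comm⟩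
  complete x₁ y₁ x₂ y₂ p q hp hq hb := h.complete _ _ _ _ q p hq hp (hb.rotate hM)

/-! ### Cutting the paths of the new graph at a pivot edge -/

/-- The paths for the edge set `E'` are those paths for `E` whose end points satisfy `base`, and the
paths obtained from two paths for `E` by joining them with an edge that satisfies `piv`. -/
structure Transition {U : Type} (E E' : Set (U × U × U)) (base : U → U → Prop)
    (piv : U → U → U → Prop) : Prop where
  base_path : ∀ x y q, base x y → IsPath E x q y → IsPath E' x q y
  piv_mem : ∀ c l d, piv c l d → (c, l, d) ∈ E'
  piv_left : ∀ c l d x q, piv c l d → IsPath E x q c → IsPath E' x q c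
  piv_right : ∀ c l d q y, piv c l d → IsPath E d q y → IsPath E' d q y
  cut : ∀ x y q, IsPath E' x q y → (base x y ∧ IsPath E x q y) ∨
    ∃ q₁ c l d q₂, q = q₁ ++ (c, l, d) :: q₂ ∧ piv c l d ∧ IsPath E x q₁ c ∧ IsPath E d q₂ y

/-- Acyclicity allows a path to use the new edge at most once, so the parts before and after it are
old paths. -/
theorem Transition.insert {U : Type} {E : Set (U × U × U)} {u l v : U}
    (hE : IsAcyclicGraph (insert (u, l, v) E)) :
    Transition E (insert (u, l, v) E) (fun _ _ => True)
      (fun a b c => a = u ∧ b = l ∧ c = v) where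
  base_path _ _ _ _ h := h.mono (Set.subset_insert _ _)
  piv_mem := by
    rintro _ _ _ ⟨rfl, rfl, rfl⟩
    exact Set.mem_insert _ _
  piv_left _ _ _ _ _ _ h := h.mono (Set.subset_insert _ _)
  piv_right _ _ _ _ _ _ h := h.mono (Set.subset_insert _ _)
  cut x y q hq := by
    have key : ∀ {x y q}, IsPath (Insert.insert (u, l, v) E) x q y → (u, l, v) ∉ q →
        IsPath E x q y :=
      fun hq h => hq.mono_of_mem fun e he h' => h'.resolve_left fun h' => h (h' ▸ he)
    by_cases h : (u, l, v) ∈ q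
    · obtain ⟨q₁, q₂, rfl⟩ := List.append_of_mem h
      obtain ⟨h₁, h₂⟩ := hE.notMem hq
      obtain ⟨m, hq₁, hq⟩ := isPath_append_iff.1 hq
      obtain ⟨hm, -, hq₂⟩ := isPath_cons_iff.1 hq
      obtain rfl : u = m := hm
      exact .inr ⟨q₁, u, l, v, q₂, rfl, ⟨rfl, rfl, rfl⟩, key hq₁ h₁, key hq₂ h₂⟩
    · exact .inl ⟨trivial, key hq h⟩

theorem IsPath.exists_crossing {U : Type} {E : Set (U × U × U)} {x y : U}
    {q : List (U × U × U)} (hq : IsPath E x q y) (φ : U → Prop) (hx : φ x) (hy : ¬ φ y) :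
    ∃ q₁ c l d q₂, q = q₁ ++ (c, l, d) :: q₂ ∧ (c, l, d) ∈ E ∧ φ c ∧ ¬ φ d ∧
      IsPath E x q₁ c ∧ IsPath E d q₂ y := by
  induction hq with
  | nil s => exact (hy hx).elim
  | cons s l m p t he hp ih =>
    by_cases hm : φ m
    · obtain ⟨q₁, c, l', d, q₂, rfl, h, hc, hd, h₁, h₂⟩ := ih hm hy
      exact ⟨(s, l, m) :: q₁, c, l', d, q₂, rfl, h, hc, hd, .cons _ _ _ _ _ he h₁, h₂⟩
    · exact ⟨[], s, l, m, p, rfl, he, hx, hm, .nil s, hp⟩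

/-- If `x` does not reach `u`, or `y` does, then no path from `x` to `y` uses the deleted edge: its
use would give a path from `x` to `u`, or close a cycle with the path from `y` to `u`. Otherwise a
path that survives has to leave the set of vertices reaching `u`, and it does so along a pivot. The
same criterion shows that all old paths into the pivot's source and out of its target survive. -/
theorem Transition.delete {U : Type} {E : Set (U × U × U)} {u l v : U}
    (hE : IsAcyclicGraph E) {reach : U → U → Prop}
    (hr : ∀ a b, reach a b ↔ ∃ p, IsPath E a p b) :
    Transition E (E \ {(u, l, v)}) (fun x y => ¬ reach x u ∨ reach y u)
      (fun a b c => ((a, b, c) ∈ E ∧ ¬ (a = u ∧ b = l ∧ c = v)) ∧ reach a u ∧ ¬ reach c u) := by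
  have hsub : E \ {(u, l, v)} ⊆ E := Set.sdiff_subset
  have key : ∀ x y q, (¬ reach x u ∨ reach y u) → IsPath E x q y →
      IsPath (E \ {(u, l, v)}) x q y := by
    intro x y q h hq
    refine hq.mono_of_mem fun e he h' => ⟨h', ?_⟩
    rintro rfl
    obtain ⟨q₁, q₂, rfl⟩ := List.append_of_mem he
    obtain ⟨m, hq₁, hq⟩ := isPath_append_iff.1 hq
    obtain ⟨hm, he', hq₂⟩ := isPath_cons_iff.1 hq
    obtain rfl : u = m := hm
    rcases h with h | h
    · exact h ((hr _ _).2 ⟨_, hq₁⟩)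
    · obtain ⟨p, hp⟩ := (hr _ _).1 h
      simpa using hE u ((u, l, v) :: (q₂ ++ p))
        (isPath_cons_iff.2 ⟨rfl, he', hq₂.append hp⟩)
  refine ⟨key, ?_, ?_, ?_, ?_⟩
  · rintro c l' d ⟨⟨h, h'⟩, -⟩
    exact ⟨h, fun h => h' (by simpa using h)⟩
  · rintro c l' d x q ⟨-, h, -⟩ hq
    exact key _ _ _ (.inr h) hq
  · rintro c l' d q y ⟨-, -, h⟩ hq
    exact key _ _ _ (.inl h) hq
  · intro x y q hq
    by_cases h : ¬ reach x u ∨ reach y u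
    · exact .inl ⟨h, hq.mono hsub⟩
    · rw [not_or, not_not] at h
      obtain ⟨q₁, c, l', d, q₂, rfl, he, hc, hd, h₁, h₂⟩ :=
        hq.exists_crossing (fun a => reach a u) h.1 h.2
      exact .inr ⟨q₁, c, l', d, q₂, rfl, ⟨⟨he.1, fun h => he.2 (by simpa using h)⟩, hc, hd⟩,
        h₁.mono hsub, h₂.mono hsub⟩

/-! ### The update of Dyck pairs -/

namespace DyckState

open Witnessed

variable {U : Type} (s : DyckState U)

def pair (x₁ y₁ x₂ y₂ : U) : Witnessed U := ⟨s.rel x₁ y₁ x₂ y₂, s.wit x₁ y₁ x₂ y₂⟩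

/-- There are paths from `c'` to `c` and from `d` to `d'` such that their labels form a Dyck word
with the letter `l` between them. One of them is empty and the other one is empty or consists of a
Dyck path and an edge that is matched with `l`. -/
def bridge (ord : U → U → Prop) (c l d c' d' : U) : Witnessed U :=
  (empty (s.neutral l ∧ c' = c ∧ d' = d)).or
    (((ex ord fun e => ex ord fun l' =>
      (single (s.edge e l' d' ∧ s.matching l l') e l' d').and (s.pair d e e e)).guard (c' = c)).or
    ((ex ord fun e => ex ord fun l' =>
      (single (s.edge c' l' e ∧ s.matching l' l) c' l' e).and (s.pair e c c c)).guard (d' = d)))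

/-- The pivot edge `(c, l, d)` of the second path is matched with an edge of the first path. -/
def crossMatch (ord : U → U → Prop) (edge₁ : U → U → U → Prop) (X : U → U → U → U → Witnessed U)
    (c l d x₁ y₁ x₂ y₂ : U) : Witnessed U :=
  ex ord fun a => ex ord fun l' => ex ord fun b =>
    (single (edge₁ a l' b ∧ s.matching l' l) a l' b).and ((X x₁ a d y₂).and (X b y₁ x₂ c))

/-- The pivot edge `(c, l, d)` of the second path is neutral or matched within that path. -/
def innerMatch (ord : U → U → Prop) (X : U → U → U → U → Witnessed U)
    (c l d x₁ y₁ x₂ y₂ : U) : Witnessed U :=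
  ex ord fun c' => ex ord fun d' => (s.bridge ord c l d c' d').and
    (ex ord fun n₁ => ex ord fun n₂ => (s.pair n₁ c' d' n₂).and
      (((X x₁ y₁ x₂ n₁).and (X x₁ x₁ n₂ y₂)).or
        (ex ord fun m => (X m y₁ x₂ n₁).and (X x₁ m n₂ y₂))))

/-- Dyck pairs after the edges available to the second path have changed. -/
def stage (ord : U → U → Prop) (edge₁ : U → U → U → Prop) (base : U → U → Prop)
    (piv : U → U → U → Prop) (X : U → U → U → U → Witnessed U) (x₁ y₁ x₂ y₂ : U) : Witnessed U :=
  ((X x₁ y₁ x₂ y₂).guard (base x₂ y₂)).or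
    (ex ord fun c => ex ord fun l => ex ord fun d => (single (piv c l d) c l d).and
      ((s.crossMatch ord edge₁ X c l d x₁ y₁ x₂ y₂).or (s.innerMatch ord X c l d x₁ y₁ x₂ y₂)))

/-- Dyck pairs after a change of the edges. -/
def nextPair (ord : U → U → Prop) (edge : U → U → U → Prop) (base : U → U → Prop)
    (piv : U → U → U → Prop) : U → U → U → U → Witnessed U :=
  s.stage ord edge base piv fun x₁ y₁ x₂ y₂ => s.stage ord s.edge base piv s.pair x₂ y₂ x₁ y₁

/-- `base` and `piv` are the data of a `Transition`, which lets insertion and deletion share one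
update. -/
def next (ord : U → U → Prop) (edge : U → U → U → Prop) (base : U → U → Prop)
    (piv : U → U → U → Prop) : DyckState U where
  edge := edge
  reach x y := base x y ∧ s.reach x y ∨ ∃ c l d, piv c l d ∧ s.reach x c ∧ s.reach d y
  ord := ord
  neutral := s.neutral
  matching := s.matching
  rel x₁ y₁ x₂ y₂ := (s.nextPair ord edge base piv x₁ y₁ x₂ y₂).holds
  wit x₁ y₁ x₂ y₂ := (s.nextPair ord edge base piv x₁ y₁ x₂ y₂).wit

/-- The state after the insertion of the edge `o`. -/
def ins (o : Fin 3 → U) : DyckState U :=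
  s.next (activate (activate (activate s.ord (o 0)) (o 1)) (o 2))
    (fun a b c => (a = o 0 ∧ b = o 1 ∧ c = o 2) ∨ s.edge a b c) (fun _ _ => True)
    (fun a b c => a = o 0 ∧ b = o 1 ∧ c = o 2)

/-- The state after the deletion of the edge `o`. -/
def del (o : Fin 3 → U) : DyckState U :=
  s.next s.ord (fun a b c => s.edge a b c ∧ ¬ (a = o 0 ∧ b = o 1 ∧ c = o 2))
    (fun x y => ¬ s.reach x (o 0) ∨ s.reach y (o 0))
    (fun a b c => (s.edge a b c ∧ ¬ (a = o 0 ∧ b = o 1 ∧ c = o 2)) ∧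
      s.reach a (o 0) ∧ ¬ s.reach c (o 0))

/-- All end points and labels of edges are activated. -/
def Covers (ord : U → U → Prop) (edge : U → U → U → Prop) : Prop :=
  ∀ a l b, edge a l b → ord a a ∧ ord l l ∧ ord b b

/-- The invariant of the program. `covers` ensures that quantifiers restricted to activated elements
miss no edge, and `symm` permits exchanging the two paths of a pair. -/
structure Correct : Prop where
  reach : ∀ a b, s.reach a b ↔ ∃ p, IsPath (edgeSet s.edge) a p b
  order : IsActivationOrder s.ord
  covers : Covers s.ord s.edge
  symm : ∀ a b, s.matching a b → s.matching b a
  pairs : DecidesPairs s.neutral s.matching (edgeSet s.edge) (edgeSet s.edge) s.pair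

/-! ### Soundness and completeness of the update -/

variable {s} {ord : U → U → Prop} {edge edge₁ : U → U → U → Prop} {base : U → U → Prop}
  {piv : U → U → U → Prop} {X : U → U → U → U → Witnessed U}

/-- The second path runs from `b` to `b`, so it is empty by acyclicity. -/
theorem Correct.of_pair (hs : s.Correct) (hE : IsAcyclicGraph (edgeSet s.edge)) {a b : U}
    (h : (s.pair a b b b).holds) :
    ∃ p, IsPath (edgeSet s.edge) a p b ∧ BalancedWord s.neutral s.matching (labels p) ∧
      ∀ x l y, (s.pair a b b b).wit x l y ↔ (x, l, y) ∈ p := by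
  obtain ⟨p, q, hp, hq, hb, hS⟩ := hs.pairs.sound _ _ _ _ h
  obtain rfl := hE _ _ hq
  exact ⟨p, hp, by simpa using hb, by simpa using hS⟩

theorem Correct.to_pair (hs : s.Correct) {a b : U} {p : List (U × U × U)}
    (hp : IsPath (edgeSet s.edge) a p b) (hb : BalancedWord s.neutral s.matching (labels p)) :
    (s.pair a b b b).holds :=
  hs.pairs.complete _ _ _ _ p [] hp (.nil _) (by simpa using hb)

theorem Correct.bridge_sound (hs : s.Correct) (hE : IsAcyclicGraph (edgeSet s.edge))
    (ho : IsActivationOrder ord) (c l d c' d' : U) :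
    (s.bridge ord c l d c' d').Sound fun S => ∃ p q, IsPath (edgeSet s.edge) c' p c ∧
      IsPath (edgeSet s.edge) d q d' ∧
      BalancedWord s.neutral s.matching (labels p ++ l :: labels q) ∧
      ∀ a l b, S a l b ↔ (a, l, b) ∈ p ∨ (a, l, b) ∈ q := by
  refine .or ?_ (.or (.guard ?_) (.guard ?_))
  · rintro ⟨hl, rfl, rfl⟩
    exact ⟨[], [], .nil _, .nil _, .single hl, by simp [empty]⟩
  · rintro rfl
    refine .ex ho fun e => .ex ho fun l' => ?_
    rintro ⟨⟨he, hl⟩, h⟩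
    obtain ⟨p, hp, hb, hS⟩ := hs.of_pair hE h
    refine ⟨[], p ++ [(e, l', d')], .nil _,
      hp.append (isPath_cons_iff.2 ⟨rfl, he, .nil _⟩), by simpa using BalancedWord.enclose hl hb, ?_⟩
    simp [and_wit, single_wit, hS, or_comm]
  · rintro rfl
    refine .ex ho fun e => .ex ho fun l' => ?_
    rintro ⟨⟨he, hl⟩, h⟩
    obtain ⟨p, hp, hb, hS⟩ := hs.of_pair hE h
    refine ⟨(c', l', e) :: p, [], isPath_cons_iff.2 ⟨rfl, he, hp⟩, .nil _,
      by simpa using BalancedWord.enclose hl hb, ?_⟩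
    simp [and_wit, single_wit, hS]

theorem stage_sound (hs : s.Correct) (hE : IsAcyclicGraph (edgeSet s.edge))
    (ho : IsActivationOrder ord) {E' : Set (U × U × U)} (ht : Transition (edgeSet s.edge) E' base piv)
    (hX : DecidesPairs s.neutral s.matching (edgeSet edge₁) (edgeSet s.edge) X)
    (x₁ y₁ x₂ y₂ : U) :
    (s.stage ord edge₁ base piv X x₁ y₁ x₂ y₂).Sound
      (IsDyckPair s.neutral s.matching (edgeSet edge₁) E' x₁ y₁ x₂ y₂) := by
  refine .or (.guard fun h h' => ?_) (.ex ho fun c => .ex ho fun l => .ex ho fun d => ?_)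
  · obtain ⟨p, q, hp, hq, hb, hS⟩ := hX.sound _ _ _ _ h'
    exact ⟨p, q, hp, ht.base_path _ _ _ h hq, hb, hS⟩
  refine .and fun hpiv => .or ?_ ?_
  · refine .ex ho fun a => .ex ho fun l' => .ex ho fun b => ?_
    rintro ⟨⟨he, hl⟩, h₁, h₂⟩
    obtain ⟨p₁, q₂, hp₁, hq₂, hb₁, hS₁⟩ := hX.sound _ _ _ _ h₁
    obtain ⟨p₂, q₁, hp₂, hq₁, hb₂, hS₂⟩ := hX.sound _ _ _ _ h₂
    refine ⟨p₁ ++ (a, l', b) :: p₂, q₁ ++ (c, l, d) :: q₂,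
      hp₁.append (isPath_cons_iff.2 ⟨rfl, he, hp₂⟩),
      (ht.piv_left _ _ _ _ _ hpiv hq₁).append (isPath_cons_iff.2
        ⟨rfl, ht.piv_mem _ _ _ hpiv, ht.piv_right _ _ _ _ _ hpiv hq₂⟩), ?_, ?_⟩
    -- The matched edges enclose `p₂` and `q₁`, and this block sits between `p₁` and `q₂`.
    · simpa using BalancedWord.insert hb₁ (.enclose hl hb₂)
    · intro x y z
      simp only [and_wit, single_wit, hS₁, hS₂, List.mem_append, List.mem_cons, Prod.mk.injEq]
      tauto
  · refine .ex ho fun c' => .ex ho fun d' => .and fun hbr => .ex ho fun n₁ => .ex ho fun n₂ =>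
      .and fun hR => ?_
    obtain ⟨g₁, g₂, hg₁, hg₂, hb, hS⟩ := hs.bridge_sound hE ho _ _ _ _ _ hbr
    obtain ⟨r₁, r₂, hr₁, hr₂, hb', hS'⟩ := hs.pairs.sound _ _ _ _ hR
    -- The alternative without a quantifier is the case `m = x₁`.
    suffices key : ∀ m, ((X m y₁ x₂ n₁).and (X x₁ m n₂ y₂)).Sound _ from
      .or (key x₁) (.ex ho key)
    rintro m ⟨h₁, h₂⟩
    obtain ⟨p₂, q₁, hp₂, hq₁, hb₂, hS₂⟩ := hX.sound _ _ _ _ h₁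
    obtain ⟨p₁, q₂, hp₁, hq₂, hb₁, hS₁⟩ := hX.sound _ _ _ _ h₂
    refine ⟨p₁ ++ p₂, (q₁ ++ (r₁ ++ g₁)) ++ (c, l, d) :: (g₂ ++ (r₂ ++ q₂)), hp₁.append hp₂,
      (ht.piv_left _ _ _ _ _ hpiv (hq₁.append (hr₁.append hg₁))).append (isPath_cons_iff.2
        ⟨rfl, ht.piv_mem _ _ _ hpiv, ht.piv_right _ _ _ _ _ hpiv
          (hg₂.append (hr₂.append hq₂))⟩), ?_, ?_⟩
    · simpa using BalancedWord.insert hb₁ (.append hb₂ (.insert hb' hb))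
    · intro x y z
      simp only [and_wit, single_wit, hS, hS', hS₁, hS₂, List.mem_append, List.mem_cons,
        Prod.mk.injEq]
      exact Iff.of_eq (by ac_rfl)

/-- Once the pivot's block is removed, `tripod` splits the three remaining paths into exactly the
three pairs that the formula queries. -/
theorem Correct.innerMatch_complete (hs : s.Correct) (hc : Covers ord s.edge)
    (hc₁ : Covers ord edge₁)
    (hX : DecidesPairs s.neutral s.matching (edgeSet edge₁) (edgeSet s.edge) X)
    {c l d c' d' x₁ y₁ x₂ y₂ : U} (hc' : ord c' c') (hd' : ord d' d')
    (hbr : (s.bridge ord c l d c' d').holds) {p q r : List (U × U × U)}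
    (hp : IsPath (edgeSet edge₁) x₁ p y₁) (hq : IsPath (edgeSet s.edge) x₂ q c')
    (hr : IsPath (edgeSet s.edge) d' r y₂)
    (hb : BalancedWord s.neutral s.matching (labels p ++ (labels q ++ labels r))) :
    (s.innerMatch ord X c l d x₁ y₁ x₂ y₂).holds := by
  obtain ⟨p₁, p₂, q₁, q₂, r₁, r₂, hp', hq', hr', h₁, h₂, h₃⟩ := hb.tripod
  obtain ⟨p₁, p₂, rfl, rfl, rfl⟩ := labels_eq_append hp'
  obtain ⟨q₁, q₂, rfl, rfl, rfl⟩ := labels_eq_append hq'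
  obtain ⟨r₁, r₂, rfl, rfl, rfl⟩ := labels_eq_append hr'
  obtain ⟨m, hp₁, hp₂⟩ := isPath_append_iff.1 hp
  obtain ⟨n₁, hq₁, hq₂⟩ := isPath_append_iff.1 hq
  obtain ⟨n₂, hr₁, hr₂⟩ := isPath_append_iff.1 hr
  have hn₁ : ord n₁ n₁ := by
    rcases hq₂.eq_or_source with rfl | ⟨l, v, h⟩
    · exact hc'
    · exact (hc _ _ _ h).1
  have hn₂ : ord n₂ n₂ := by
    rcases hr₁.eq_or_target with rfl | ⟨l, v, h⟩
    · exact hd'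
    · exact (hc _ _ _ h).2.2
  refine ⟨c', hc', d', hd', hbr, n₁, hn₁, n₂, hn₂, hs.pairs.complete _ _ _ _ _ _ hq₂ hr₁ h₂, ?_⟩
  have hX₁ := hX.complete _ _ _ _ _ _ hp₂ hq₁ h₁
  have hX₂ := hX.complete _ _ _ _ _ _ hp₁ hr₂ h₃
  -- Unlike `c'` and `d'`, the vertex `x₁` need not be activated, so a cut at `x₁` itself may be out
  -- of reach of the quantifier and has its own alternative.
  rcases hp₁.eq_or_target with rfl | ⟨l, v, h⟩
  · exact .inl ⟨hX₁, hX₂⟩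
  · exact .inr ⟨m, (hc₁ _ _ _ h).2.2, hX₁, hX₂⟩

/-- Completeness follows the partner of the pivot's letter: none, in `q₂`, in `q₁`, or in `p`. The
first three fall under `innerMatch`, the last under `crossMatch`. -/
theorem Correct.stage_decides (hs : s.Correct) (hE : IsAcyclicGraph (edgeSet s.edge))
    (ho : IsActivationOrder ord) (hc : Covers ord s.edge) (hc₁ : Covers ord edge₁)
    (hce : Covers ord edge) (ht : Transition (edgeSet s.edge) (edgeSet edge) base piv)
    (hX : DecidesPairs s.neutral s.matching (edgeSet edge₁) (edgeSet s.edge) X) :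
    DecidesPairs s.neutral s.matching (edgeSet edge₁) (edgeSet edge)
      (s.stage ord edge₁ base piv X) := by
  refine ⟨stage_sound hs hE ho ht hX, fun x₁ y₁ x₂ y₂ p q hp hq hb => ?_⟩
  rcases ht.cut _ _ _ hq with ⟨h, hq⟩ | ⟨q₁, c, l, d, q₂, rfl, hpiv, hq₁, hq₂⟩
  · exact .inl ⟨h, hX.complete _ _ _ _ _ _ hp hq hb⟩
  obtain ⟨hc', hl', hd'⟩ := hce _ _ _ (ht.piv_mem _ _ _ hpiv)
  refine .inr ⟨c, hc', l, hl', d, hd', hpiv, ?_⟩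
  rw [labels_append, labels_cons, ← List.append_assoc] at hb
  rcases hb.remove with ⟨hl, hb⟩ | ⟨v₁, b, v₂, hv, hl, h₁, h₂⟩ | ⟨u₁, a, u₂, hu, hl, h₁, h₂⟩
  · exact .inr (hs.innerMatch_complete hc hc₁ hX hc' hd' (.inl ⟨hl, rfl, rfl⟩) hp hq₁ hq₂
      (by simpa using hb))
  · obtain ⟨r, e, f, r', rfl, rfl, rfl⟩ := labels_eq_append_cons hv
    obtain ⟨m, hr, hm'⟩ := isPath_append_iff.1 hq₂
    obtain ⟨hm, he, hr'⟩ := isPath_cons_iff.1 hm'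
    obtain rfl : e = m := hm
    obtain ⟨he₁, hb', hf⟩ := hc _ _ _ he
    exact .inr (hs.innerMatch_complete hc hc₁ hX hc' hf
      (.inr (.inl ⟨rfl, e, he₁, b, hb', ⟨he, hl⟩, hs.to_pair hr h₁⟩)) hp hq₁ hr'
      (by simpa using h₂))
  -- The partner lies in `q₁`; `z = []` makes it the first letter there, a case that arises again
  -- below from the other alternative.
  · have key : ∀ z, u₁ = labels p ++ z → labels q₁ = z ++ a :: u₂ →
        (s.innerMatch ord X c l d x₁ y₁ x₂ y₂).holds := by
      rintro z rfl hz
      obtain ⟨r, f, e, r', rfl, rfl, rfl⟩ := labels_eq_append_cons hz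
      obtain ⟨m, hr, hm'⟩ := isPath_append_iff.1 hq₁
      obtain ⟨hm, he, hr'⟩ := isPath_cons_iff.1 hm'
      obtain rfl : f = m := hm
      obtain ⟨hf, ha, he₁⟩ := hc _ _ _ he
      exact hs.innerMatch_complete hc hc₁ hX hf hd'
        (.inr (.inr ⟨rfl, e, he₁, a, ha, ⟨he, hl⟩, hs.to_pair hr' h₁⟩)) hp hr hq₂
        (by simpa using h₂)
    rcases List.append_eq_append_iff.1 hu with ⟨z, hz, hz'⟩ | ⟨z, hz, hz'⟩
    · exact .inr (key z hz hz')
    · rcases z with _ | ⟨a', z⟩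
      · exact .inr (key [] (by simpa using hz.symm) (by simpa using hz'.symm))
      · obtain ⟨rfl, rfl⟩ := List.cons.inj hz'
        obtain ⟨r, e, f, r', rfl, rfl, rfl⟩ := labels_eq_append_cons hz
        obtain ⟨m, hr, hm'⟩ := isPath_append_iff.1 hp
        obtain ⟨hm, he, hr'⟩ := isPath_cons_iff.1 hm'
        obtain rfl : e = m := hm
        obtain ⟨he₁, ha, hf⟩ := hc₁ _ _ _ he
        exact .inl ⟨e, he₁, a, ha, f, hf, ⟨he, hl⟩, hX.complete _ _ _ _ _ _ hr hq₂ h₂,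
          hX.complete _ _ _ _ _ _ hr' hq₁ h₁⟩

theorem Correct.next (hs : s.Correct) (hE : IsAcyclicGraph (edgeSet s.edge))
    (ho : IsActivationOrder ord) (hc : Covers ord s.edge) (hce : Covers ord edge)
    (ht : Transition (edgeSet s.edge) (edgeSet edge) base piv) :
    (s.next ord edge base piv).Correct where
  reach a b := by
    simp only [DyckState.next, hs.reach]
    constructor
    · rintro (⟨h, p, hp⟩ | ⟨c, l, d, h, ⟨p, hp⟩, q, hq⟩)
      · exact ⟨p, ht.base_path _ _ _ h hp⟩
      · exact ⟨_, (ht.piv_left _ _ _ _ _ h hp).append (isPath_cons_iff.2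
          ⟨rfl, ht.piv_mem _ _ _ h, ht.piv_right _ _ _ _ _ h hq⟩)⟩
    · rintro ⟨q, hq⟩
      rcases ht.cut _ _ _ hq with ⟨h, hq⟩ | ⟨q₁, c, l, d, q₂, rfl, hpiv, hq₁, hq₂⟩
      · exact .inl ⟨h, _, hq⟩
      · exact .inr ⟨c, l, d, hpiv, ⟨_, hq₁⟩, _, hq₂⟩
  order := ho
  covers := hce
  symm := hs.symm
  -- The inner stage renews one path while the other is old. After the swap the renewed path comes
  -- first, and the outer stage renews the second.
  pairs := hs.stage_decides hE ho hc hce hce ht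
    ((hs.stage_decides hE ho hc hc hce ht hs.pairs).swap hs.symm)

theorem Correct.ins (hs : s.Correct) {o : Fin 3 → U}
    (hE : IsAcyclicGraph (insert (o 0, o 1, o 2) (edgeSet s.edge))) : (s.ins o).Correct := by
  have hset : insert (o 0, o 1, o 2) (edgeSet s.edge) =
      edgeSet fun a b c => (a = o 0 ∧ b = o 1 ∧ c = o 2) ∨ s.edge a b c := by
    ext ⟨a, b, c⟩
    simp [edgeSet]
  have hord : ∀ a, s.ord a a →
      activate (activate (activate s.ord (o 0)) (o 1)) (o 2) a a := fun a h =>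
    activate_of_ord (activate_of_ord (activate_of_ord h))
  have hc : Covers (activate (activate (activate s.ord (o 0)) (o 1)) (o 2)) s.edge :=
    fun a l b h => (hs.covers a l b h).imp (hord a) (.imp (hord l) (hord b))
  refine hs.next (fun x p hp => hE x p (hp.mono (Set.subset_insert _ _)))
    (((hs.order.activate _).activate _).activate _) hc ?_ (hset ▸ Transition.insert hE)
  rintro a l b (⟨rfl, rfl, rfl⟩ | h)
  · exact ⟨activate_of_ord (activate_of_ord activate_self), activate_of_ord activate_self,
      activate_self⟩
  · exact hc _ _ _ h

theorem Correct.del (hs : s.Correct) {o : Fin 3 → U} (hE : IsAcyclicGraph (edgeSet s.edge)) :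
    (s.del o).Correct := by
  have hset : edgeSet s.edge \ {(o 0, o 1, o 2)} =
      edgeSet fun a b c => s.edge a b c ∧ ¬ (a = o 0 ∧ b = o 1 ∧ c = o 2) := by
    ext ⟨a, b, c⟩
    simp [edgeSet]
  exact hs.next hE hs.order hs.covers (fun a l b h => hs.covers a l b h.1)
    (hset ▸ Transition.delete hE hs.reach)

end DyckState

/-! ### First-order definability -/

section Definability

open FirstOrder.Language

variable {L : FirstOrder.Language.{0, 0}} {α β : Type}

/-- The property `φ` of structures and assignments is defined by a first-order formula. -/
def FODef (φ : ∀ A : Type, L.Structure A → (α → A) → Prop) : Prop :=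
  ∃ F : L.Formula α, ∀ (A : Type) (S : L.Structure A) (v : α → A),
    @Formula.Realize L A S α F v ↔ φ A S v

namespace FODef

variable {φ ψ : ∀ A : Type, L.Structure A → (α → A) → Prop}

theorem relMap {n : ℕ} (R : L.Relations n) (g : Fin n → α) {x : ∀ A : Type, (α → A) → Fin n → A}
    (hx : ∀ A v k, x A v k = v (g k)) :
    FODef fun A (S : L.Structure A) (v : α → A) => S.RelMap R (x A v) :=
  ⟨R.formula fun k => Term.var (g k), fun A S v => by simp [funext (hx A v)]⟩

theorem eq (i j : α) : FODef fun A (_ : L.Structure A) v => v i = v j :=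
  ⟨(Term.var i).equal (Term.var j), fun _ _ _ => by simp⟩

theorem false : FODef fun A (_ : L.Structure A) (_ : α → A) => False :=
  ⟨⊥, fun _ _ _ => by simp⟩

theorem not (h : FODef φ) : FODef fun A S v => ¬ φ A S v :=
  let ⟨F, hF⟩ := h
  ⟨F.not, fun A S v => by simp [hF]⟩

theorem true : FODef fun A (_ : L.Structure A) (_ : α → A) => True :=
  ⟨⊤, fun _ _ _ => by simp⟩

theorem and (h : FODef φ) (h' : FODef ψ) : FODef fun A S v => φ A S v ∧ ψ A S v :=
  let ⟨F, hF⟩ := h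
  let ⟨G, hG⟩ := h'
  ⟨F ⊓ G, fun A S v => by simp [hF, hG]⟩

theorem or (h : FODef φ) (h' : FODef ψ) : FODef fun A S v => φ A S v ∨ ψ A S v :=
  let ⟨F, hF⟩ := h
  let ⟨G, hG⟩ := h'
  ⟨F ⊔ G, fun A S v => by simp [hF, hG]⟩

theorem imp (h : FODef φ) (h' : FODef ψ) : FODef fun A S v => φ A S v → ψ A S v :=
  let ⟨F, hF⟩ := h
  let ⟨G, hG⟩ := h'
  ⟨F.imp G, fun A S v => by simp [hF, hG]⟩

theorem relabel (f : α → β) (h : FODef φ) : FODef fun A S (v : β → A) => φ A S fun i => v (f i) :=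
  let ⟨F, hF⟩ := h
  ⟨F.relabel f, fun A S v => by simp [hF, Function.comp_def]⟩

theorem exist {φ : ∀ A : Type, L.Structure A → (α → A) → A → Prop}
    (h : FODef fun A S (v : Option α → A) => φ A S (fun i => v (some i)) (v none)) :
    FODef fun A S v => ∃ a, φ A S v a := by
  obtain ⟨F, hF⟩ := h
  refine ⟨(F.relabel fun i : Option α => i.elim (Sum.inr ()) Sum.inl).iExs Unit,
    fun A S v => ?_⟩
  simp only [Formula.realize_iExs, Formula.realize_relabel, hF]
  exact ⟨fun ⟨i, hi⟩ => ⟨i (), hi⟩, fun ⟨a, ha⟩ => ⟨fun _ => a, ha⟩⟩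

theorem all {φ : ∀ A : Type, L.Structure A → (α → A) → A → Prop}
    (h : FODef fun A S (v : Option α → A) => φ A S (fun i => v (some i)) (v none)) :
    FODef fun A S v => ∀ a, φ A S v a := by
  obtain ⟨F, hF⟩ := h.not.exist (φ := fun A S v a => ¬ φ A S v a)
  exact ⟨F.not, fun A S v => by simp [hF]⟩

end FODef

/-- Definability of a proposition and its witness. -/
def FOWit (w : ∀ A : Type, L.Structure A → (α → A) → Witnessed A) : Prop :=
  (FODef fun A S v => (w A S v).holds) ∧
    ∀ i j k, FODef fun A S v => (w A S v).wit (v i) (v j) (v k)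

namespace FOWit

variable {w w' : ∀ A : Type, L.Structure A → (α → A) → Witnessed A}
  {φ : ∀ A : Type, L.Structure A → (α → A) → Prop}

theorem and (h : FOWit w) (h' : FOWit w') : FOWit fun A S v => (w A S v).and (w' A S v) :=
  ⟨h.1.and h'.1, fun i j k => (h.2 i j k).or (h'.2 i j k)⟩

theorem or (h : FOWit w) (h' : FOWit w') : FOWit fun A S v => (w A S v).or (w' A S v) :=
  ⟨h.1.or h'.1, fun i j k => (h.1.and (h.2 i j k)).or (h.1.not.and (h'.2 i j k))⟩

theorem guard (h : FODef φ) (h' : FOWit w) : FOWit fun A S v => (w A S v).guard (φ A S v) :=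
  ⟨h.and h'.1, h'.2⟩

theorem single (h : FODef φ) (i j k : α) :
    FOWit fun A S v => Witnessed.single (φ A S v) (v i) (v j) (v k) :=
  ⟨h, fun _ _ _ => (FODef.eq _ _).and ((FODef.eq _ _).and (FODef.eq _ _))⟩

theorem empty (h : FODef φ) : FOWit fun A S v => Witnessed.empty (φ A S v) :=
  ⟨h, fun _ _ _ => FODef.false⟩

/-- Minimality quantifies over a further element, so `ord` has to be definable in every larger
context of variables. -/
theorem ex {ord : ∀ A : Type, L.Structure A → (α → A) → A → A → Prop}
    {w : ∀ A : Type, L.Structure A → (α → A) → A → Witnessed A}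
    (ho : ∀ {β : Type} (f : α → β) (i j : β),
      FODef fun A S (v : β → A) => ord A S (fun k => v (f k)) (v i) (v j))
    (hw : FOWit fun A S (v : Option α → A) => w A S (fun i => v (some i)) (v none)) :
    FOWit fun A S v => Witnessed.ex (ord A S v) (w A S v) := by
  refine ⟨.exist ((ho _ _ _).and hw.1), fun i j k => .exist (.and (.and (ho _ _ _)
    (hw.1.and (.all ((ho _ _ _).imp (.imp ?_ (ho _ _ _)))))) (hw.2 (some i) (some j) (some k)))⟩
  -- The formula for the candidate is reused for its competitor: the innermost variable takes its
  -- place, and parameters skip the candidate.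
  exact hw.1.relabel fun i : Option α => i.elim none fun i => some (some i)

end FOWit

end Definability

/-! ### The dynamic program -/

/-- Relation symbols of the auxiliary vocabulary. -/
inductive DyckAuxRel : ℕ → Type
  | edge : DyckAuxRel 3
  | reach : DyckAuxRel 2
  | ord : DyckAuxRel 2
  | neutral : DyckAuxRel 1
  | matching : DyckAuxRel 2
  | rel : DyckAuxRel 4
  | wit : DyckAuxRel 7

/-- The auxiliary vocabulary. -/
def dyckAux : FirstOrder.Language.{0, 0} where
  Functions := fun _ => Empty
  Relations := DyckAuxRel

theorem finite_dyckAux_symbols : Finite dyckAux.Symbols := by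
  have h₁ : Finite (Σ n, dyckAux.Functions n) :=
    @Finite.of_subsingleton _ ⟨fun a => Empty.elim a.2⟩
  have h₂ : Finite (Σ n, dyckAux.Relations n) := by
    refine Set.finite_univ_iff.mp (Set.Finite.subset (Set.toFinite
      ({⟨3, DyckAuxRel.edge⟩, ⟨2, DyckAuxRel.reach⟩, ⟨2, DyckAuxRel.ord⟩, ⟨1, DyckAuxRel.neutral⟩,
        ⟨2, DyckAuxRel.matching⟩, ⟨4, DyckAuxRel.rel⟩, ⟨7, DyckAuxRel.wit⟩} :
        Set (Σ n, dyckAux.Relations n))) ?_)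
    rintro ⟨n, R⟩ -
    cases R <;> simp
  exact inferInstanceAs (Finite (_ ⊕ _))

/-! ### First-order definability of the states and updates -/

namespace DyckState

def relMap {U : Type} (s : DyckState U) : ∀ {n : ℕ}, DyckAuxRel n → (Fin n → U) → Prop
  | _, .edge => fun x => s.edge (x 0) (x 1) (x 2)
  | _, .reach => fun x => s.reach (x 0) (x 1)
  | _, .ord => fun x => s.ord (x 0) (x 1)
  | _, .neutral => fun x => s.neutral (x 0)
  | _, .matching => fun x => s.matching (x 0) (x 1)
  | _, .rel => fun x => s.rel (x 0) (x 1) (x 2) (x 3)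
  | _, .wit => fun x => s.wit (x 0) (x 1) (x 2) (x 3) (x 4) (x 5) (x 6)

def ofStructure {U : Type} (S : dyckAux.Structure U) : DyckState U where
  edge a l b := S.RelMap DyckAuxRel.edge ![a, l, b]
  reach a b := S.RelMap DyckAuxRel.reach ![a, b]
  ord a b := S.RelMap DyckAuxRel.ord ![a, b]
  neutral a := S.RelMap DyckAuxRel.neutral ![a]
  matching a b := S.RelMap DyckAuxRel.matching ![a, b]
  rel a b c d := S.RelMap DyckAuxRel.rel ![a, b, c, d]
  wit a b c d x l y := S.RelMap DyckAuxRel.wit ![a, b, c, d, x, l, y]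

theorem ofStructure_eq {U : Type} {S : dyckAux.Structure U} {s : DyckState U}
    (h : ∀ {n : ℕ} (R : DyckAuxRel n) (x : Fin n → U), S.RelMap R x ↔ s.relMap R x) :
    ofStructure S = s := by
  cases s
  simp only [ofStructure, mk.injEq]
  refine ⟨?_, ?_, ?_, ?_, ?_, ?_, ?_⟩ <;> funext <;> exact propext (h _ _)

/-- The initial state. -/
def start {U : Type} (S : dyckLang.Structure U) : DyckState U where
  edge _ _ _ := False
  reach a b := a = b
  ord _ _ := False
  neutral a := S.RelMap DyckRel.neutral ![a]
  matching a b := (S.RelMap DyckRel.pos ![a] ∨ S.RelMap DyckRel.neg ![a]) ∧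
    S.RelMap DyckRel.bar ![a, b]
  rel a b c d := a = b ∧ c = d
  wit _ _ _ _ _ _ _ := False

/-- The output predicates. -/
def output {U : Type} (s : DyckState U) : ∀ o : DyckOut, (Fin o.arity → U) → Prop
  | .reach => fun x : Fin 2 → U => s.rel (x 0) (x 1) (x 1) (x 1)
  | .witness => fun x : Fin 5 → U => s.rel (x 0) (x 1) (x 1) (x 1) ∧
      (x 2 = x 4 ∨ s.wit (x 0) (x 1) (x 1) (x 1) (x 2) (x 3) (x 4))
  | .allowed => fun x : Fin 3 → U => ¬ s.reach (x 2) (x 0)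

section

variable {α : Type}

theorem fodef_edge (i j k : α) : FODef fun A S v =>
    (ofStructure (U := A) S).edge (v i) (v j) (v k) :=
  FODef.relMap (L := dyckAux) DyckAuxRel.edge ![i, j, k]
    (x := fun _ v => ![v i, v j, v k]) fun _ _ k => by fin_cases k <;> rfl

theorem fodef_reach (i j : α) : FODef fun A S v =>
    (ofStructure (U := A) S).reach (v i) (v j) :=
  FODef.relMap (L := dyckAux) DyckAuxRel.reach ![i, j]
    (x := fun _ v => ![v i, v j]) fun _ _ k => by fin_cases k <;> rfl

theorem fodef_ord (i j : α) : FODef fun A S v =>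
    (ofStructure (U := A) S).ord (v i) (v j) :=
  FODef.relMap (L := dyckAux) DyckAuxRel.ord ![i, j]
    (x := fun _ v => ![v i, v j]) fun _ _ k => by fin_cases k <;> rfl

theorem fodef_neutral (i : α) : FODef fun A S v =>
    (ofStructure (U := A) S).neutral (v i) :=
  FODef.relMap (L := dyckAux) DyckAuxRel.neutral ![i]
    (x := fun _ v => ![v i]) fun _ _ k => by fin_cases k; rfl

theorem fodef_matching (i j : α) : FODef fun A S v =>
    (ofStructure (U := A) S).matching (v i) (v j) :=
  FODef.relMap (L := dyckAux) DyckAuxRel.matching ![i, j]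
    (x := fun _ v => ![v i, v j]) fun _ _ k => by fin_cases k <;> rfl

theorem fodef_rel (i j k l : α) : FODef fun A S v =>
    (ofStructure (U := A) S).rel (v i) (v j) (v k) (v l) :=
  FODef.relMap (L := dyckAux) DyckAuxRel.rel ![i, j, k, l]
    (x := fun _ v => ![v i, v j, v k, v l]) fun _ _ k => by fin_cases k <;> rfl

theorem fodef_wit (i j k l a b c : α) : FODef fun A S v =>
    (ofStructure (U := A) S).wit (v i) (v j) (v k) (v l) (v a) (v b) (v c) :=
  FODef.relMap (L := dyckAux) DyckAuxRel.wit ![i, j, k, l, a, b, c]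
    (x := fun _ v => ![v i, v j, v k, v l, v a, v b, v c]) fun _ _ k => by fin_cases k <;> rfl

theorem fowit_pair (i j k l : α) : FOWit fun A S v =>
    (ofStructure (U := A) S).pair (v i) (v j) (v k) (v l) :=
  ⟨fodef_rel i j k l, fun _ _ _ => fodef_wit _ _ _ _ _ _ _⟩

end

section

variable {α : Type} {ord : ∀ A : Type, dyckAux.Structure A → (Fin 3 → A) → A → A → Prop}
  {edge : ∀ A : Type, dyckAux.Structure A → (Fin 3 → A) → A → A → A → Prop}
  {base : ∀ A : Type, dyckAux.Structure A → (Fin 3 → A) → A → A → Prop}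
  {piv : ∀ A : Type, dyckAux.Structure A → (Fin 3 → A) → A → A → A → Prop}
  {X : ∀ A : Type, dyckAux.Structure A → (Fin 3 → A) → A → A → A → A → Witnessed A}

theorem fowit_bridge
    (ho : ∀ {α : Type} (g : Fin 3 → α) i j, FODef fun A S v =>
      ord A S (fun k => v (g k)) (v i) (v j)) (g : Fin 3 → α) (c l d c' d' : α) :
    FOWit fun A S v => (ofStructure S).bridge (ord A S fun k => v (g k))
      (v c) (v l) (v d) (v c') (v d') := by
  unfold bridge
  repeat' first
    | exact fodef_edge _ _ _ | exact fodef_matching _ _ | exact fodef_neutral _ | exact .eq _ _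
    | exact fowit_pair _ _ _ _ | apply ho | apply FOWit.single | apply FOWit.and
    | apply FOWit.or | apply FOWit.guard | apply FOWit.empty | apply FODef.and | (apply FOWit.ex <;> intros <;> beta_reduce)

theorem fowit_stage
    (ho : ∀ {α : Type} (g : Fin 3 → α) i j, FODef fun A S v =>
      ord A S (fun k => v (g k)) (v i) (v j))
    (he : ∀ {α : Type} (g : Fin 3 → α) i j m, FODef fun A S v =>
      edge A S (fun k => v (g k)) (v i) (v j) (v m))
    (hb : ∀ {α : Type} (g : Fin 3 → α) i j, FODef fun A S v =>
      base A S (fun k => v (g k)) (v i) (v j))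
    (hp : ∀ {α : Type} (g : Fin 3 → α) i j m, FODef fun A S v =>
      piv A S (fun k => v (g k)) (v i) (v j) (v m))
    (hX : ∀ {α : Type} (g : Fin 3 → α) i j m n, FOWit fun A S v =>
      X A S (fun k => v (g k)) (v i) (v j) (v m) (v n))
    (g : Fin 3 → α) (x₁ y₁ x₂ y₂ : α) :
    FOWit fun A S v => (ofStructure S).stage (ord A S fun k => v (g k))
      (edge A S fun k => v (g k)) (base A S fun k => v (g k)) (piv A S fun k => v (g k))
      (X A S fun k => v (g k)) (v x₁) (v y₁) (v x₂) (v y₂) := by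
  unfold stage crossMatch innerMatch
  repeat' first
    | exact fodef_matching _ _ | exact fowit_pair _ _ _ _ | apply ho | apply he | apply hb
    | apply hp | apply hX | exact fowit_bridge ho _ _ _ _ _ _ | apply FOWit.single
    | apply FOWit.and | apply FOWit.or | apply FOWit.guard | apply FODef.and | (apply FOWit.ex <;> intros <;> beta_reduce)

/-- The map `g` locates the operation's arguments among the variables. The hypotheses hold in every
context because the update uses them under quantifiers. -/
theorem fodef_next
    (ho : ∀ {α : Type} (g : Fin 3 → α) i j, FODef fun A S v =>
      ord A S (fun k => v (g k)) (v i) (v j))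
    (he : ∀ {α : Type} (g : Fin 3 → α) i j m, FODef fun A S v =>
      edge A S (fun k => v (g k)) (v i) (v j) (v m))
    (hb : ∀ {α : Type} (g : Fin 3 → α) i j, FODef fun A S v =>
      base A S (fun k => v (g k)) (v i) (v j))
    (hp : ∀ {α : Type} (g : Fin 3 → α) i j m, FODef fun A S v =>
      piv A S (fun k => v (g k)) (v i) (v j) (v m))
    (g : Fin 3 → α) {n : ℕ} (R : DyckAuxRel n) (x : Fin n → α) :
    FODef fun A S v => ((ofStructure S).next (ord A S fun k => v (g k))
      (edge A S fun k => v (g k)) (base A S fun k => v (g k))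
      (piv A S fun k => v (g k))).relMap R fun k => v (x k) := by
  have hs : ∀ x₁ y₁ x₂ y₂ : α, FOWit fun A S v => (ofStructure S).nextPair
      (ord A S fun k => v (g k)) (edge A S fun k => v (g k)) (base A S fun k => v (g k))
      (piv A S fun k => v (g k)) (v x₁) (v y₁) (v x₂) (v y₂) :=
    fowit_stage (X := fun A S o x₁ y₁ x₂ y₂ => (ofStructure S).stage (ord A S o)
      (ofStructure S).edge (base A S o) (piv A S o) (ofStructure S).pair x₂ y₂ x₁ y₁) ho he hb hp
      (fun g i j m n => fowit_stage (edge := fun A S _ => (ofStructure S).edge)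
        (X := fun A S _ => (ofStructure S).pair) ho (fun _ _ _ _ => fodef_edge _ _ _) hb hp
        (fun _ _ _ _ _ => fowit_pair _ _ _ _) g m n i j) g
  cases R
  · exact he g _ _ _
  · refine .or ((hb g _ _).and (fodef_reach _ _)) (.exist (.exist (.exist (.and ?_ (.and ?_ ?_)))))
    · exact hp (fun k => some (some (some (g k)))) _ _ _
    · exact fodef_reach (some (some (some (x 0)))) _
    · exact fodef_reach none (some (some (some (x 1))))
  · exact ho g _ _
  · exact fodef_neutral _
  · exact fodef_matching _ _
  · exact (hs _ _ _ _).1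
  · exact (hs _ _ _ _).2 _ _ _

theorem fodef_activate
    (ho : ∀ {α : Type} (g : Fin 3 → α) i j, FODef fun A S v =>
      ord A S (fun k => v (g k)) (v i) (v j)) (z : Fin 3) (g : Fin 3 → α) (i j : α) :
    FODef fun A S v => activate (ord A S fun k => v (g k)) (v (g z)) (v i) (v j) :=
  (ho g i j).or ((ho g _ _).not.and ((FODef.eq _ _).and ((ho g _ _).or (.eq _ _))))

end

theorem fodef_eq_edge {α : Type} (g : Fin 3 → α) (i j k : α) :
    FODef fun A (_ : dyckAux.Structure A) v => v i = v (g 0) ∧ v j = v (g 1) ∧ v k = v (g 2) :=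
  (FODef.eq _ _).and ((FODef.eq _ _).and (FODef.eq _ _))

theorem fodef_ins {n : ℕ} (R : DyckAuxRel n) : FODef (α := Fin 3 ⊕ Fin n) fun _ S v =>
    ((ofStructure S).ins fun k => v (.inl k)).relMap R fun k => v (.inr k) := by
  refine fodef_next
    (ord := fun A S o => activate (activate (activate (ofStructure S).ord (o 0)) (o 1)) (o 2))
    (edge := fun A S o a b c => (a = o 0 ∧ b = o 1 ∧ c = o 2) ∨ (ofStructure S).edge a b c)
    (base := fun A S o _ _ => True)
    (piv := fun A S o a b c => a = o 0 ∧ b = o 1 ∧ c = o 2)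
    ?_ ?_ ?_ ?_ Sum.inl R Sum.inr
  · exact fodef_activate
      (ord := fun A S o => activate (activate (ofStructure S).ord (o 0)) (o 1))
      (fodef_activate (ord := fun A S o => activate (ofStructure S).ord (o 0))
      (fodef_activate (ord := fun A S o => (ofStructure S).ord) (fun _ => fodef_ord) 0) 1) 2
  · exact fun g i j k => (fodef_eq_edge g i j k).or (fodef_edge _ _ _)
  · exact fun _ _ _ => .true
  · exact fodef_eq_edge

theorem fodef_del {n : ℕ} (R : DyckAuxRel n) : FODef (α := Fin 3 ⊕ Fin n) fun _ S v =>
    ((ofStructure S).del fun k => v (.inl k)).relMap R fun k => v (.inr k) := by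
  have he {α : Type} (g : Fin 3 → α) (i j k : α) : FODef fun A S v =>
      (ofStructure (U := A) S).edge (v i) (v j) (v k) ∧
        ¬ (v i = v (g 0) ∧ v j = v (g 1) ∧ v k = v (g 2)) :=
    (fodef_edge _ _ _).and (fodef_eq_edge g i j k).not
  exact fodef_next
    (ord := fun A S o => (ofStructure S).ord)
    (edge := fun A S o a b c => (ofStructure S).edge a b c ∧ ¬ (a = o 0 ∧ b = o 1 ∧ c = o 2))
    (base := fun A S o x y => ¬ (ofStructure S).reach x (o 0) ∨ (ofStructure S).reach y (o 0))
    (piv := fun A S o a b c =>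
      ((ofStructure S).edge a b c ∧ ¬ (a = o 0 ∧ b = o 1 ∧ c = o 2)) ∧
        (ofStructure S).reach a (o 0) ∧ ¬ (ofStructure S).reach c (o 0))
    (fun _ => fodef_ord) he (fun _ _ _ => (fodef_reach _ _).not.or (fodef_reach _ _))
    (fun g i j k => (he g i j k).and ((fodef_reach _ _).and (fodef_reach _ _).not))
    Sum.inl R Sum.inr

theorem fodef_start {n : ℕ} (R : DyckAuxRel n) :
    FODef fun _ (S : dyckLang.Structure _) (v : Fin n → _) => (start S).relMap R v := by
  have h₁ {n : ℕ} (R : DyckRel 1) (i : Fin n) :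
      FODef fun A (S : dyckLang.Structure A) (v : Fin n → A) => S.RelMap R ![v i] :=
    FODef.relMap (L := dyckLang) R ![i] (x := fun _ v => ![v i]) fun _ _ k => by
      fin_cases k; rfl
  have h₂ {n : ℕ} (R : DyckRel 2) (i j : Fin n) :
      FODef fun A (S : dyckLang.Structure A) (v : Fin n → A) => S.RelMap R ![v i, v j] :=
    FODef.relMap (L := dyckLang) R ![i, j] (x := fun _ v => ![v i, v j]) fun _ _ k => by
      fin_cases k <;> rfl
  cases R
  · exact .false
  · exact .eq 0 1
  · exact .false
  · exact h₁ _ 0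
  · exact ((h₁ _ 0).or (h₁ _ 0)).and (h₂ _ 0 1)
  · exact (FODef.eq 0 1).and (.eq 2 3)
  · exact .false

theorem fodef_output (o : DyckOut) :
    FODef fun _ (S : dyckAux.Structure _) (v : Fin o.arity → _) => (ofStructure S).output o v := by
  cases o
  · exact fodef_rel (α := Fin 2) 0 1 1 1
  · exact (fodef_rel (α := Fin 5) 0 1 1 1).and
      ((FODef.eq (α := Fin 5) 2 4).or (fodef_wit (α := Fin 5) 0 1 1 1 2 3 4))
  · exact (fodef_reach (α := Fin 3) 2 0).not

end DyckState

open DyckState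

/-- The dynamic program for Dyck reachability with witness. -/
noncomputable def dyckProgram : DynFOProgram dyckWitness where
  aux := dyckAux
  aux_relational := fun _ => (inferInstance : IsEmpty Empty)
  aux_finite := finite_dyckAux_symbols
  init := fun R => (fodef_start R).choose
  update := fun o _ R => match o with
    | .ins => (fodef_ins R).choose
    | .del => (fodef_del R).choose
  output := fun o => (fodef_output o).choose

theorem ofStructure_initState {A : Type} (S : dyckLang.Structure A) :
    ofStructure (dyckProgram.initState S) = start S :=
  ofStructure_eq fun R x => (fodef_start R).choose_spec A S x

theorem ofStructure_step_ins {A : Type} (S : dyckAux.Structure A) (x : Fin 3 → A) :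
    ofStructure (dyckProgram.step S ⟨.ins, x⟩) = (ofStructure S).ins x :=
  ofStructure_eq fun R y => (fodef_ins R).choose_spec A S (Sum.elim x y)

theorem ofStructure_step_del {A : Type} (S : dyckAux.Structure A) (x : Fin 3 → A) :
    ofStructure (dyckProgram.step S ⟨.del, x⟩) = (ofStructure S).del x :=
  ofStructure_eq fun R y => (fodef_del R).choose_spec A S (Sum.elim x y)

theorem dyckProgram_out_iff (i : DyckInput) (w : List (EdgeUpdate i.V i.L)) (o : DyckOut)
    (x : Fin o.arity → i.V ⊕ i.L) :
    dyckProgram.out i w o x ↔ (ofStructure (dyckProgram.run i w)).output o x :=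
  (fodef_output o).choose_spec _ _ x

/-! ### From labelled graphs to graphs on the universe -/

section Transfer

variable {V L : Type}

/-- An edge as a triple of elements of the universe. -/
def liftEdge (e : V × L × V) : (V ⊕ L) × (V ⊕ L) × (V ⊕ L) := (.inl e.1, .inr e.2.1, .inl e.2.2)

theorem liftEdge_injective : Function.Injective (liftEdge : V × L × V → _) := by
  rintro ⟨a, l, b⟩ ⟨a', l', b'⟩ h
  simpa [liftEdge] using h

variable {E : Set (V × L × V)}

theorem IsPath.lift {s t : V} {p : List (V × L × V)} (h : IsPath E s p t) :
    IsPath (liftEdge '' E) (.inl s) (p.map liftEdge) (.inl t) := by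
  induction h with
  | nil s => exact .nil _
  | cons s l m p t he _ ih => exact .cons _ _ _ _ _ ⟨_, he, rfl⟩ ih

/-- Lifted edges lead from vertices to vertices, so a path that starts at a vertex never meets a
label as an end point. -/
theorem IsPath.exists_of_lift {p : List ((V ⊕ L) × (V ⊕ L) × (V ⊕ L))} {x y : V ⊕ L}
    (h : IsPath (liftEdge '' E) x p y) {s : V} (hx : x = .inl s) :
    ∃ q t, y = .inl t ∧ p = q.map liftEdge ∧ IsPath E s q t := by
  induction h generalizing s with
  | nil => exact ⟨[], s, hx, rfl, .nil s⟩
  | cons x l m p y he _ ih =>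
    obtain ⟨⟨a, l', b⟩, he', he⟩ := he
    simp only [liftEdge, Prod.mk.injEq] at he
    obtain ⟨rfl, rfl, rfl⟩ := he
    obtain rfl : a = s := Sum.inl.inj hx
    obtain ⟨q, t, rfl, rfl, hq⟩ := ih rfl
    exact ⟨(a, l', b) :: q, t, rfl, rfl, .cons _ _ _ _ _ he' hq⟩

theorem exists_isPath_lift_iff {s t : V} :
    (∃ p, IsPath (liftEdge '' E) (.inl s) p (.inl t)) ↔ ∃ p, IsPath E s p t := by
  constructor
  · rintro ⟨p, hp⟩
    obtain ⟨q, t', ht, rfl, hq⟩ := hp.exists_of_lift rfl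
    exact ⟨q, Sum.inl.inj ht ▸ hq⟩
  · rintro ⟨p, hp⟩
    exact ⟨_, hp.lift⟩

theorem IsAcyclicGraph.lift (hE : IsAcyclicGraph E) : IsAcyclicGraph (liftEdge '' E) := by
  rintro x p hp
  rcases p with _ | ⟨e, p⟩
  · rfl
  · obtain ⟨he, ⟨⟨a, l, b⟩, -, rfl⟩, -⟩ := isPath_cons_iff.1 hp
    obtain rfl : Sum.inl a = x := he
    obtain ⟨q, t, ht, hq, hp⟩ := hp.exists_of_lift rfl
    obtain rfl := Sum.inl.inj ht
    rw [hE _ _ hp] at hq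
    simp at hq

namespace DyckAlphabet

variable (α : DyckAlphabet L)

/-- The neutral letters, as elements of the universe. -/
def liftNeutral (a : V ⊕ L) : Prop := ∃ l ∈ α.neutral, a = .inr l

/-- The matching of letters, as a relation on the universe. -/
def liftMatching (a b : V ⊕ L) : Prop :=
  ∃ l ∈ α.pos ∪ α.neg, a = .inr l ∧ b = .inr (α.bar l)

theorem liftMatching_symm (a b : V ⊕ L) (h : α.liftMatching a b) : α.liftMatching b a := by
  obtain ⟨l, hl, rfl, rfl⟩ := h
  exact ⟨α.bar l, hl.symm.imp (α.bar_neg l) (α.bar_pos l), rfl, by rw [α.bar_bar]⟩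

end DyckAlphabet

theorem balancedWord_lift_iff {α : DyckAlphabet L} {w : List L} :
    BalancedWord (U := V ⊕ L) α.liftNeutral α.liftMatching (w.map Sum.inr) ↔ IsDyckWord α w := by
  constructor
  · intro h
    generalize hx : w.map Sum.inr = x at h
    induction h generalizing w with
    | nil =>
      obtain rfl := List.map_eq_nil_iff.1 hx
      exact .nil
    | pair a b u v hM _ _ ihu ihv =>
      obtain ⟨l, hl, rfl, rfl⟩ := hM
      obtain ⟨l', w, rfl, hl', hx⟩ := List.map_eq_cons_iff.1 hx
      obtain ⟨w₁, w', rfl, rfl, hx'⟩ := List.map_eq_append_iff.1 hx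
      obtain ⟨l'', w₂, rfl, hl'', rfl⟩ := List.map_eq_cons_iff.1 hx'
      obtain rfl := Sum.inr.inj hl'
      obtain rfl := Sum.inr.inj hl''
      exact .pair _ _ _ hl (ihu rfl) (ihv rfl)
    | neutral a u v hN _ _ ihu ihv =>
      obtain ⟨l, hl, rfl⟩ := hN
      obtain ⟨w₁, w', rfl, rfl, hx'⟩ := List.map_eq_append_iff.1 hx
      obtain ⟨l', w₂, rfl, hl', rfl⟩ := List.map_eq_cons_iff.1 hx'
      obtain rfl := Sum.inr.inj hl'
      exact .neutral _ _ _ hl (ihu rfl) (ihv rfl)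
  · intro h
    induction h with
    | nil => exact .nil
    | pair l u v hl _ _ ihu ihv =>
      simpa using BalancedWord.pair _ _ _ _ ⟨l, hl, rfl, rfl⟩ ihu ihv
    | neutral l u v hl _ _ ihu ihv =>
      simpa using BalancedWord.neutral _ _ _ ⟨l, hl, rfl⟩ ihu ihv

theorem labels_map_liftEdge (p : List (V × L × V)) :
    labels (p.map liftEdge) = (p.map fun e => e.2.1).map Sum.inr := by
  simp [labels, liftEdge, Function.comp_def]

/-- The state correctly describes the labelled graph `E`. -/
structure DyckState.Describes (s : DyckState (V ⊕ L)) (α : DyckAlphabet L)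
    (E : Set (V × L × V)) : Prop where
  correct : s.Correct
  edgeSet_eq : edgeSet s.edge = liftEdge '' E
  neutral_eq : s.neutral = α.liftNeutral
  matching_eq : s.matching = α.liftMatching

namespace DyckState.Describes

variable {s : DyckState (V ⊕ L)} {α : DyckAlphabet L}

theorem ins (h : s.Describes α E) {u v : V} {l : L} (hE : IsAcyclicGraph (insert (u, l, v) E)) :
    (s.ins ![.inl u, .inr l, .inl v]).Describes α (insert (u, l, v) E) where
  correct := h.correct.ins (by
    have := hE.lift
    rwa [Set.image_insert_eq, ← h.edgeSet_eq] at this)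
  edgeSet_eq := by
    rw [Set.image_insert_eq, ← h.edgeSet_eq]
    ext ⟨a, b, c⟩
    simp [edgeSet, DyckState.ins, DyckState.next, liftEdge]
  neutral_eq := h.neutral_eq
  matching_eq := h.matching_eq

theorem del (h : s.Describes α E) {u v : V} {l : L} (hE : IsAcyclicGraph E) :
    (s.del ![.inl u, .inr l, .inl v]).Describes α (E \ {(u, l, v)}) where
  correct := h.correct.del (h.edgeSet_eq ▸ hE.lift)
  edgeSet_eq := by
    rw [Set.image_sdiff liftEdge_injective, Set.image_singleton, ← h.edgeSet_eq]
    ext ⟨a, b, c⟩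
    simp [edgeSet, DyckState.del, DyckState.next, liftEdge]
  neutral_eq := h.neutral_eq
  matching_eq := h.matching_eq

theorem exists_dyckPath_of_rel (h : s.Describes α E) (hE : IsAcyclicGraph E) {a b : V}
    (hr : s.rel (.inl a) (.inl b) (.inl b) (.inl b)) : ∃ p, IsDyckPath α E a p b ∧
      ∀ x l y, s.wit (.inl a) (.inl b) (.inl b) (.inl b) (.inl x) (.inr l) (.inl y) ↔
        (x, l, y) ∈ p := by
  have hE' : IsAcyclicGraph (edgeSet s.edge) := h.edgeSet_eq ▸ hE.lift
  obtain ⟨p, hp, hb, hS⟩ := h.correct.of_pair hE' hr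
  rw [h.edgeSet_eq] at hp
  obtain ⟨q, t, ht, rfl, hq⟩ := hp.exists_of_lift rfl
  obtain rfl := Sum.inl.inj ht
  rw [h.neutral_eq, h.matching_eq, labels_map_liftEdge, balancedWord_lift_iff] at hb
  refine ⟨q, ⟨hq, hb⟩, fun x l y => (hS _ _ _).trans ?_⟩
  exact List.mem_map_of_injective liftEdge_injective (a := (x, l, y))

theorem rel_of_dyckPath (h : s.Describes α E) {a b : V} {p : List (V × L × V)}
    (hp : IsDyckPath α E a p b) : s.rel (.inl a) (.inl b) (.inl b) (.inl b) := by
  refine h.correct.to_pair (p := p.map liftEdge) (h.edgeSet_eq ▸ hp.1.lift) ?_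
  rw [h.neutral_eq, h.matching_eq, labels_map_liftEdge, balancedWord_lift_iff]
  exact hp.2

theorem dyckCorrect (h : s.Describes α E) (hE : IsAcyclicGraph E) :
    DyckCorrect α E s.output := by
  refine ⟨fun a b => ⟨⟨fun hr => ?_, fun ⟨p, hp⟩ => h.rel_of_dyckPath hp⟩, fun ⟨p, hp⟩ => ?_,
    fun hn u l v hw => ?_⟩, fun u l v => ?_⟩
  · obtain ⟨p, hp, -⟩ := h.exists_dyckPath_of_rel hE hr
    exact ⟨p, hp⟩
  · have hr := h.rel_of_dyckPath hp
    obtain ⟨q, hq, hw⟩ := h.exists_dyckPath_of_rel hE hr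
    refine ⟨q, hq, fun u l v => ?_⟩
    rw [Represents, ← hw]
    -- `Represents` contains the diagonal, which the stored edge set lacks; the output formula adds
    -- it, guarded by the existence of a Dyck path.
    exact ⟨fun hh => hh.2.imp_left Sum.inl.inj, fun hh => ⟨hr, hh.imp_left (congrArg Sum.inl)⟩⟩
  · obtain ⟨p, hp, -⟩ := h.exists_dyckPath_of_rel hE hw.1
    exact hn ⟨p, hp⟩
  · rw [isAcyclicGraph_insert_iff hE, ← exists_isPath_lift_iff, ← h.edgeSet_eq]
    exact not_congr (h.correct.reach _ _)

end DyckState.Describes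

end Transfer

/-! ### Induction over the sequence of operations -/

theorem describes_start (i : DyckInput) :
    (start (dyckStructure i)).Describes i.alphabet (∅ : Set (i.V × i.L × i.V)) := by
  have hm : (start (dyckStructure i)).matching = i.alphabet.liftMatching := by
    funext a b
    refine propext ⟨?_, ?_⟩
    · rintro ⟨h, l, ha, hb⟩
      obtain rfl : a = .inr l := ha
      refine ⟨l, h.imp ?_ ?_, rfl, hb⟩ <;>
      · rintro ⟨l', hl', h⟩
        obtain rfl := Sum.inr.inj h
        exact hl'
    · rintro ⟨l, hl, rfl, rfl⟩
      exact ⟨hl.imp (fun h => ⟨l, h, rfl⟩) fun h => ⟨l, h, rfl⟩, l, rfl, rfl⟩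
  have hp : ∀ {a p b}, IsPath (edgeSet (start (dyckStructure i)).edge) a p b → a = b ∧ p = [] := by
    rintro a p b (_ | ⟨_, _, _, _, _, h, _⟩)
    · exact ⟨rfl, rfl⟩
    · exact h.elim
  refine ⟨⟨?_, ?_, ?_, ?_, ?_, ?_⟩, ?_, rfl, hm⟩
  · intro a b
    exact ⟨fun h => ⟨[], (show a = b from h) ▸ .nil a⟩, fun ⟨p, h⟩ => (hp h).1⟩
  · exact ⟨fun _ => 0, 0, by simp, by simp, by simp [start]⟩
  · exact fun _ _ _ h => h.elim
  · rw [hm]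
    exact i.alphabet.liftMatching_symm
  · rintro a b c d ⟨rfl, rfl⟩
    exact ⟨[], [], .nil _, .nil _, .nil, by simp [pair, start]⟩
  · intro a b c d p q h h' _
    exact ⟨(hp h).1, (hp h').1⟩
  · rw [Set.image_empty]
    rfl

theorem describes_run (i : DyckInput) (w : List (EdgeUpdate i.V i.L))
    (hw : ∀ w', w' <+: w → IsAcyclicGraph (edgesAfter w')) :
    (ofStructure (dyckProgram.run i w)).Describes i.alphabet (edgesAfter w) := by
  induction w using List.reverseRecOn with
  | nil => exact ofStructure_initState (dyckStructure i) ▸ describes_start i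
  | append_singleton w a ih =>
    have h := ih fun w' h => hw w' (h.trans (List.prefix_append _ _))
    have hE := hw w (List.prefix_append _ _)
    have hE' := hw _ (List.prefix_refl _)
    have hrun : dyckProgram.run i (w ++ [a]) =
        dyckProgram.step (dyckProgram.run i w) (dyckWitness.code i a) := List.foldl_concat ..
    have hedges : edgesAfter (w ++ [a]) = a.apply (edgesAfter w) := List.foldl_concat ..
    rw [hrun, hedges]
    rw [hedges] at hE'
    cases a with
    -- An insertion needs acyclicity of the graph after it, a deletion that of the graph before it.
    | ins u l v => exact ofStructure_step_ins (dyckProgram.run i w) _ ▸ h.ins hE'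
    | del u l v => exact ofStructure_step_del (dyckProgram.run i w) _ ▸ h.del hE

theorem mainTheorem2 : InDynFO dyckWitness := by
  refine ⟨dyckProgram, fun i w hw => ?_⟩
  have h := (describes_run i w hw).dyckCorrect (hw w (List.prefix_refl _))
  have ho : dyckProgram.out i w = (ofStructure (dyckProgram.run i w)).output := by
    funext o x
    exact propext (dyckProgram_out_iff i w o x)
  rw [ho]
  exact h
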